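/- A 3-graph $H$ consists of a finite vertex set $V(H)$ and a set $E(H)$ of 3-element subsets of $V(H)$, called edges; its minimum degree $\delta_1(H)$ is the smallest number of edges containing a given vertex. A copy of a 3-graph $F$ in $H$ is a (not necessarily induced) subgraph of $H$ isomorphic to $F$, and $H$ has an $F$-covering if every vertex of $H$ lies in some copy of $F$ in $H$. Let $$c_1(n,F)=\max\{\delta_1(H): H \text{ is a 3-graph on } n \text{ vertices with no } F\text{-covering}\}.$$ Writing $abc$ for $\{a,b,c\}$ and $[m]=\{1,\dots,m\}$, let $LP_3=([7],\{123,345,567\})$, $TP_3=([5],\{123,234,345\})$, $GP_3=([6],\{123,234,456\})$, $K_{1,1,3}=([5],\{123,124,125\})$, $S_3=([7],\{123,145,167\})$ and $GS_3=([6],\{123,124,156\})$. Then: 1. $c_1(n,LP_3)=n-2$ for all $n\ge 13$; 2. for all $n\ge 6$, $c_1(n,TP_3)=n-1$ if $n\equiv 1 \pmod 3$ and $n\ne 7$, and $c_1(n,TP_3)=n-2$ otherwise (in particular $c_1(7,TP_3)=5$); 3. $c_1(n,GP_3)=n-2$ for all $n\ge 14$; 4. $c_1(n,K_{1,1,3})=n-1$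 for all $n\ge 9$; 5. $c_1(n,S_3)=n-1$ for all $n\ge 11$; 6. $c_1(n,GS_3)=\lfloor (n-1)/2\rfloor$ for all $n\ge 13$. -/

import Mathlib

/-- A (simple) `k`-uniform hypergraph on the vertex set `V`: a finite set of `k`-element subsets
of `V`, called edges. -/
structure UniformHypergraph (V : Type*) (k : ℕ) where
  edges : Finset (Finset V)
  card_of_mem_edges : ∀ e ∈ edges, e.card = k

namespace UniformHypergraph

/-- The degree of a vertex set `S`: the number of edges containing `S`
(equivalently, the number of sets `T` disjoint from `S` such that `T ∪ S` is an edge). -/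
def degree {V : Type*} [DecidableEq V] {k : ℕ} (H : UniformHypergraph V k) (S : Finset V) : ℕ :=
  (H.edges.filter (fun e => S ⊆ e)).card

/-- The minimum `i`-degree: the minimum of the degrees of all `i`-element vertex sets
(meaningful when there is such a set, that is, when `i` is at most the number of vertices). -/
noncomputable def minDegree {V : Type*} [DecidableEq V] {k : ℕ} (H : UniformHypergraph V k)
    (i : ℕ) : ℕ :=
  sInf {d : ℕ | ∃ S : Finset V, S.card = i ∧ H.degree S = d}

/-- `φ` is an embedding of `F` as a (not necessarily induced) subgraph of `H`; its image is a
copy of `F` in `H`. -/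
def IsCopy {W V : Type*} {k : ℕ} (F : UniformHypergraph W k) (H : UniformHypergraph V k)
    (φ : W ↪ V) : Prop :=
  ∀ e ∈ F.edges, e.map φ ∈ H.edges

/-- `H` has an `F`-covering: every vertex of `H` is a vertex of some copy of `F` in `H`. -/
def HasCovering {W V : Type*} {k : ℕ} (F : UniformHypergraph W k) (H : UniformHypergraph V k) :
    Prop :=
  ∀ v : V, ∃ φ : W ↪ V, F.IsCopy H φ ∧ ∃ w : W, φ w = v

/-- `c` is the `i`-degree threshold `c_i(n, F)` for `F`-covering: the maximum of the minimum
`i`-degrees of the `k`-graphs on `n` vertices that have no `F`-covering (in particular, the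
maximum is attained). -/
def IsCoveringThreshold {W : Type*} {k : ℕ} (F : UniformHypergraph W k) (i n c : ℕ) : Prop :=
  IsGreatest {d : ℕ | ∃ G : UniformHypergraph (Fin n) k,
    ¬ F.HasCovering G ∧ G.minDegree i = d} c

end UniformHypergraph

/-! The six 3-graphs. The vertices are numbered from `0`, so that the vertex `j` of `[m]` is
`j - 1` here. -/

/-- The linear path `LP_3 = ([7], {123, 345, 567})`. -/
def LP3 : UniformHypergraph (Fin 7) 3 where
  edges := {{0, 1, 2}, {2, 3, 4}, {4, 5, 6}}
  card_of_mem_edges := by simp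

/-- The tight path `TP_3 = ([5], {123, 234, 345})`. -/
def TP3 : UniformHypergraph (Fin 5) 3 where
  edges := {{0, 1, 2}, {1, 2, 3}, {2, 3, 4}}
  card_of_mem_edges := by simp

/-- `GP_3 = ([6], {123, 234, 456})`. -/
def GP3 : UniformHypergraph (Fin 6) 3 where
  edges := {{0, 1, 2}, {1, 2, 3}, {3, 4, 5}}
  card_of_mem_edges := by simp

/-- The complete 3-partite 3-graph `K_{1,1,3} = ([5], {123, 124, 125})`. -/
def K113 : UniformHypergraph (Fin 5) 3 where
  edges := {{0, 1, 2}, {0, 1, 3}, {0, 1, 4}}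
  card_of_mem_edges := by simp

/-- The linear star `S_3 = ([7], {123, 145, 167})`. -/
def S3 : UniformHypergraph (Fin 7) 3 where
  edges := {{0, 1, 2}, {0, 3, 4}, {0, 5, 6}}
  card_of_mem_edges := by simp

/-- `GS_3 = ([6], {123, 124, 156})`. -/
def GS3 : UniformHypergraph (Fin 6) 3 where
  edges := {{0, 1, 2}, {0, 1, 3}, {0, 4, 5}}
  card_of_mem_edges := by simp

/-!
Lower bounds. The edges of a full star share a vertex, whereas `LP3` and `GP3` have two disjoint
edges. In the cone over a graph `G`, whose edges are the edges of `G` joined to an apex together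
with the independent triples of `G`, the link of the apex is `G` and no edge off the apex contains
an edge of `G`; taking for `G` a star or a disjoint union of triangles keeps the apex out of every
`TP3`, a cycle keeps it out of every `K113`. For `S3`, all edges at the uncovered vertex meet two
fixed vertices, and all others pass through a pivot that lies in none of these. For `GS3`, every
pair of codegree at least 2 near the uncovered vertex is contained in all edges that meet it, which
leaves no room for the edge `156`.

Upper bounds. If `v` lies in no copy of `F`, then placing `v` in the various positions of `F` makes
link edges meet: the link of `v`, or the link of a neighbour of `v` off a small set, is a star, a
triangle or a matching, or has small maximum degree. The degree of a vertex is at most the sum of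
its codegrees with a set `X` plus the number of its link edges off `X`, so that `v` or a suitable
neighbour has degree below the assumed minimum.
-/

namespace UniformHypergraph

open Finset

section Link

variable {V : Type*} [DecidableEq V] {H : UniformHypergraph V 3} {a b c : V}

/-- `H.IsEdge a b c` says that `{a, b, c}` is an edge of the 3-graph `H`. -/
def IsEdge (H : UniformHypergraph V 3) (a b c : V) : Prop := {a, b, c} ∈ H.edges

instance (H : UniformHypergraph V 3) (a b c : V) : Decidable (H.IsEdge a b c) :=
  inferInstanceAs (Decidable (_ ∈ H.edges))

theorem IsEdge.swap (h : H.IsEdge a b c) : H.IsEdge b a c := by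
  rwa [IsEdge, Finset.insert_comm]

theorem IsEdge.swap_right (h : H.IsEdge a b c) : H.IsEdge a c b := by
  rwa [IsEdge, Finset.pair_comm]

theorem IsEdge.rotate (h : H.IsEdge a b c) : H.IsEdge b c a := h.swap.swap_right

@[grind →]
theorem IsEdge.ne (h : H.IsEdge a b c) : a ≠ b ∧ a ≠ c ∧ b ≠ c := by
  have hcard : #{a, b, c} = 3 := H.card_of_mem_edges _ h
  refine ⟨?_, ?_, ?_⟩ <;> rintro rfl <;> simp at hcard <;> grind [Finset.card_le_two]

/-- The link graph of `v`: the pairs that form an edge together with `v`. -/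
def link (H : UniformHypergraph V 3) (v : V) : SimpleGraph V where
  Adj a b := H.IsEdge v a b
  symm := ⟨fun _ _ => IsEdge.swap_right⟩
  loopless := ⟨fun _ h => h.ne.2.2 rfl⟩

@[simp]
theorem link_adj {v : V} : (H.link v).Adj a b ↔ H.IsEdge v a b := Iff.rfl

instance (H : UniformHypergraph V 3) (v : V) : DecidableRel (H.link v).Adj :=
  fun a b => inferInstanceAs (Decidable (H.IsEdge v a b))

variable [Fintype V]

/-- The vertices that form an edge with `a` and `b`; their number is the codegree of `a`, `b`. -/
def nbr (H : UniformHypergraph V 3) (a b : V) : Finset V := (H.link a).neighborFinset b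

@[simp]
theorem mem_nbr : c ∈ H.nbr a b ↔ H.IsEdge a b c := SimpleGraph.mem_neighborFinset ..

theorem nbr_comm (H : UniformHypergraph V 3) (a b : V) : H.nbr a b = H.nbr b a := by
  ext c
  simpa only [mem_nbr] using ⟨IsEdge.swap, IsEdge.swap⟩

@[simp]
theorem nbr_self (H : UniformHypergraph V 3) (a : V) : H.nbr a a = ∅ := by
  ext c
  simpa using fun h : H.IsEdge a a c => h.ne.1 rfl

theorem degree_singleton (H : UniformHypergraph V 3) (v : V) :
    H.degree {v} = #(H.link v).edgeFinset := by
  have hv : ∀ e ∈ (H.link v).edgeFinset, v ∉ e.toFinset := by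
    rintro ⟨a, b⟩ he
    have h : H.IsEdge v a b := by simpa using he
    simpa [Sym2.toFinset_mk_eq] using ⟨h.ne.1, h.ne.2.1⟩
  refine (Finset.card_bij (fun e _ => insert v e.toFinset) ?_ ?_ ?_).symm
  · rintro ⟨a, b⟩ he
    simpa [Sym2.toFinset_mk_eq, IsEdge] using he
  · intro e he f hf hef
    have h : e.toFinset = f.toFinset := by
      rw [← Finset.erase_insert (hv e he), hef, Finset.erase_insert (hv f hf)]
    exact Sym2.ext fun x => by rw [← Sym2.mem_toFinset, h, Sym2.mem_toFinset]
  · intro e he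
    obtain ⟨he, hve⟩ : e ∈ H.edges ∧ v ∈ e := by simpa using he
    have hcard : #(e.erase v) = 2 := by rw [Finset.card_erase_of_mem hve, H.card_of_mem_edges e he]
    obtain ⟨a, b, -, hab⟩ := Finset.card_eq_two.1 hcard
    have heq : {v, a, b} = e := by rw [← hab, Finset.insert_erase hve]
    exact ⟨s(a, b), by simpa [IsEdge, heq] using he, by simpa [Sym2.toFinset_mk_eq] using heq⟩

theorem sum_card_nbr (H : UniformHypergraph V 3) (v : V) :
    ∑ x, #(H.nbr v x) = 2 * H.degree {v} :=
  degree_singleton H v ▸ (H.link v).sum_degrees_eq_twice_card_edges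

theorem sum_erase_card_nbr (H : UniformHypergraph V 3) (v : V) :
    ∑ x ∈ univ.erase v, #(H.nbr v x) = 2 * H.degree {v} := by
  rw [← sum_card_nbr, ← Finset.add_sum_erase _ _ (Finset.mem_univ v), nbr_self, Finset.card_empty,
    zero_add]

theorem two_mul_degree_le {v : V} {t : ℕ} (h : ∀ x ≠ v, #(H.nbr v x) ≤ t) :
    2 * H.degree {v} ≤ (Fintype.card V - 1) * t := by
  rw [← sum_erase_card_nbr, ← Finset.card_univ, ← Finset.card_erase_of_mem (Finset.mem_univ v),
    ← smul_eq_mul]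
  exact Finset.sum_le_card_nsmul _ _ _ fun x hx => h x (Finset.ne_of_mem_erase hx)

theorem card_mul_le_two_mul_degree {v : V} {S : Finset V} {t : ℕ} (h : ∀ x ∈ S, t ≤ #(H.nbr v x)) :
    #S * t ≤ 2 * H.degree {v} := by
  rw [← sum_card_nbr, ← smul_eq_mul]
  exact (Finset.card_nsmul_le_sum _ _ _ h).trans
    (Finset.sum_le_sum_of_subset (Finset.subset_univ _))

theorem card_nbr_le_degree (H : UniformHypergraph V 3) (v x : V) : #(H.nbr v x) ≤ H.degree {v} := by
  rw [degree_singleton, nbr, SimpleGraph.card_neighborFinset_eq_degree]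
  exact (H.link v).degree_le_card_edgeFinset x

theorem card_nbr_add_card_nbr_le (H : UniformHypergraph V 3) (v : V) {x y : V} (hxy : x ≠ y) :
    #(H.nbr v x) + #(H.nbr v y) ≤ H.degree {v} + if H.IsEdge v x y then 1 else 0 := by
  simp only [degree_singleton, nbr, SimpleGraph.card_neighborFinset_eq_degree,
    ← SimpleGraph.card_incidenceFinset_eq_degree]
  rw [← Finset.card_union_add_card_inter]
  refine Nat.add_le_add (Finset.card_le_card <| Finset.union_subset
    ((H.link v).incidenceFinset_subset x) ((H.link v).incidenceFinset_subset y)) ?_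
  have hmem : ∀ e ∈ (H.link v).incidenceFinset x ∩ (H.link v).incidenceFinset y,
      e = s(x, y) ∧ H.IsEdge v x y := by
    intro e he
    simp only [Finset.mem_inter, SimpleGraph.mem_incidenceFinset] at he
    obtain rfl := (Sym2.mem_and_mem_iff hxy).1 ⟨he.1.2, he.2.2⟩
    exact ⟨rfl, he.1.1⟩
  split_ifs with h
  · exact Finset.card_le_one.2 fun e he f hf => (hmem e he).1.trans (hmem f hf).1.symm
  · exact (Finset.card_eq_zero.2 <| Finset.eq_empty_of_forall_notMem
      fun e he => h (hmem e he).2).le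

theorem card_nbr_add_two_le (H : UniformHypergraph V 3) (hab : a ≠ b) :
    #(H.nbr a b) + 2 ≤ Fintype.card V := by
  rw [← Finset.card_pair hab, ← Finset.card_union_of_disjoint]
  · exact Finset.card_le_univ _
  · rw [Finset.disjoint_left]
    intro c hc
    have := (mem_nbr.1 hc).ne
    grind

theorem exists_isEdge_notMem {S : Finset V} (h : #S < #(H.nbr a b)) : ∃ c ∉ S, H.IsEdge a b c := by
  obtain ⟨c, hc, hcS⟩ := Finset.exists_mem_notMem_of_card_lt_card h
  exact ⟨c, hcS, mem_nbr.1 hc⟩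

theorem exists_two_isEdge_notMem {S : Finset V} (h : #S + 1 < #(H.nbr a b)) :
    ∃ c d, c ≠ d ∧ c ∉ S ∧ d ∉ S ∧ H.IsEdge a b c ∧ H.IsEdge a b d := by
  obtain ⟨c, hc, he⟩ := exists_isEdge_notMem ((Nat.lt_succ_self _).trans h)
  obtain ⟨d, hd, hf⟩ := exists_isEdge_notMem ((Finset.card_insert_le c S).trans_lt h)
  exact ⟨c, d, by grind, hc, by grind, he, hf⟩

end Link

section LinkOff

variable {V : Type*} [DecidableEq V] [Fintype V] {H : UniformHypergraph V 3} {v : V}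
  {X : Finset V}

/-- The edges of the link of `v` that avoid `X`, that is, the edges of `H` through `v` avoiding
`X`, each given by its two vertices other than `v`. -/
def linkOff (H : UniformHypergraph V 3) (v : V) (X : Finset V) : Finset (Sym2 V) :=
  {e ∈ (H.link v).edgeFinset | ∀ x ∈ X, x ∉ e}

theorem mk_mem_linkOff {p q : V} : s(p, q) ∈ H.linkOff v X ↔ H.IsEdge v p q ∧ p ∉ X ∧ q ∉ X := by
  simp only [linkOff, Finset.mem_filter, SimpleGraph.mem_edgeFinset, SimpleGraph.mem_edgeSet,
    link_adj, Sym2.mem_iff]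
  grind

theorem card_linkOff_le {P : Finset (Sym2 V)}
    (h : ∀ p q, H.IsEdge v p q → p ∉ X → q ∉ X → s(p, q) ∈ P) : #(H.linkOff v X) ≤ #P := by
  refine Finset.card_le_card ?_
  rintro ⟨p, q⟩ hpq
  obtain ⟨he, hp, hq⟩ := mk_mem_linkOff.1 hpq
  exact h p q he hp hq

theorem card_linkOff_eq_zero (h : ∀ p q, H.IsEdge v p q → p ∉ X → q ∈ X) :
    #(H.linkOff v X) = 0 :=
  Nat.le_zero.1 <| card_linkOff_le (P := ∅) fun p q he hp hq => absurd (h p q he hp) hq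

theorem exists_isEdge_of_linkOff_pos (h : 0 < #(H.linkOff v X)) :
    ∃ p q, H.IsEdge v p q ∧ p ∉ X ∧ q ∉ X := by
  obtain ⟨⟨p, q⟩, hpq⟩ := Finset.card_pos.1 h
  exact ⟨p, q, mk_mem_linkOff.1 hpq⟩

theorem card_linkOff_le_choose_two {T : Finset V}
    (h : ∀ p q, H.IsEdge v p q → p ∉ X → q ∉ X → p ∈ T) :
    #(H.linkOff v X) ≤ (#T).choose 2 := by
  rw [← Sym2.card_image_offDiag]
  refine card_linkOff_le fun p q he hp hq => ?_
  rw [Finset.mem_image]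
  exact ⟨(p, q), Finset.mem_offDiag.2 ⟨h p q he hp hq, h q p he.swap_right hq hp, he.ne.2.2⟩, rfl⟩

theorem card_linkOff_le_add (H : UniformHypergraph V 3) (v : V) (X : Finset V) (a : V) :
    #(H.linkOff v X) ≤ #(H.nbr v a \ X) + #(H.linkOff v (insert a X)) := by
  refine (Finset.card_le_card (t := (H.nbr v a \ X).image (s(a, ·)) ∪ H.linkOff v (insert a X))
    ?_).trans <| (Finset.card_union_le _ _).trans (Nat.add_le_add_right Finset.card_image_le _)
  rintro ⟨p, q⟩ hpq
  obtain ⟨he, hp, hq⟩ := mk_mem_linkOff.1 hpq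
  rw [Finset.mem_union, mk_mem_linkOff, Finset.mem_image]
  by_cases hpa : p = a
  · exact .inl ⟨q, by grind [mem_nbr], by rw [hpa]⟩
  by_cases hqa : q = a
  · exact .inl ⟨p, by grind [mem_nbr, he.swap_right], by rw [hqa, Sym2.eq_swap]⟩
  · exact .inr (by grind)

theorem degree_le_sum_card_nbr_add (H : UniformHypergraph V 3) (v : V) (X : Finset V) :
    H.degree {v} ≤ ∑ a ∈ X, #(H.nbr v a) + #(H.linkOff v X) := by
  induction X using Finset.induction_on with
  | empty => simp [linkOff, degree_singleton]
  | insert a X ha ih =>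
    have hoff := card_linkOff_le_add H v X a
    have hsub := Finset.card_le_card (Finset.sdiff_subset (s := H.nbr v a) (t := X))
    rw [Finset.sum_insert ha]
    lia

theorem degree_le_card_nbr_add (H : UniformHypergraph V 3) (v a : V) :
    H.degree {v} ≤ #(H.nbr v a) + #(H.linkOff v {a}) := by
  simpa only [Finset.sum_singleton] using degree_le_sum_card_nbr_add H v {a}

theorem degree_le_card_nbr_add_card_sdiff_add (H : UniformHypergraph V 3) (v a b : V) :
    H.degree {v} ≤ #(H.nbr v a) + (#(H.nbr v b \ {a}) + #(H.linkOff v {b, a})) :=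
  (degree_le_card_nbr_add H v a).trans (Nat.add_le_add_left (card_linkOff_le_add H v {a} b) _)

theorem degree_le_card_nbr {a : V} (h : ∀ p q, H.IsEdge v p q → p = a ∨ q = a) :
    H.degree {v} ≤ #(H.nbr v a) := by
  have hoff : #(H.linkOff v {a}) = 0 := card_linkOff_eq_zero (by grind)
  simpa [hoff] using degree_le_card_nbr_add H v a

theorem degree_add_two_le {a : V} (hva : v ≠ a) (h : ∀ p q, H.IsEdge v p q → p = a ∨ q = a) :
    H.degree {v} + 2 ≤ Fintype.card V :=
  (Nat.add_le_add_right (degree_le_card_nbr h) 2).trans (card_nbr_add_two_le H hva)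

end LinkOff

section Threshold

/-- The vertex `v` of `H` lies in no copy of `F`. -/
def Avoids {W V : Type*} {k : ℕ} (F : UniformHypergraph W k) (H : UniformHypergraph V k)
    (v : V) : Prop :=
  ∀ φ : W ↪ V, F.IsCopy H φ → ∀ w, φ w ≠ v

theorem not_hasCovering_iff {W V : Type*} {k : ℕ} {F : UniformHypergraph W k}
    {H : UniformHypergraph V k} : ¬ F.HasCovering H ↔ ∃ v, Avoids F H v := by
  simp only [HasCovering, Avoids]
  push Not
  rfl

/-- The `k`-graph whose edges are the images of the edges of `H` under a bijection of the
vertices. -/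
def map {U V : Type*} {k : ℕ} (e : U ≃ V) (H : UniformHypergraph U k) : UniformHypergraph V k where
  edges := H.edges.map (Finset.mapEmbedding e.toEmbedding).toEmbedding
  card_of_mem_edges := by
    simp only [Finset.mem_map]
    rintro _ ⟨f, hf, rfl⟩
    simpa using H.card_of_mem_edges f hf

theorem map_mem_edges_map {U V : Type*} {k : ℕ} {e : U ≃ V} {H : UniformHypergraph U k}
    {f : Finset U} : f.map e.toEmbedding ∈ (H.map e).edges ↔ f ∈ H.edges :=
  Finset.mem_map' (Finset.mapEmbedding e.toEmbedding).toEmbedding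

theorem degree_map {U V : Type*} [DecidableEq U] [DecidableEq V] {k : ℕ} (e : U ≃ V)
    (H : UniformHypergraph U k) (S : Finset U) :
    (H.map e).degree (S.map e.toEmbedding) = H.degree S := by
  rw [degree, degree, map, Finset.filter_map, Finset.card_map]
  congr 1
  ext f
  simp

theorem Avoids.map {U V W : Type*} {k : ℕ} {F : UniformHypergraph W k} {H : UniformHypergraph U k}
    {v : U} (h : Avoids F H v) (e : U ≃ V) : Avoids F (H.map e) (e v) := by
  intro φ hφ w hw
  refine h (φ.trans e.symm.toEmbedding) (fun f hf => ?_) w (by simp [hw])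
  rw [← map_mem_edges_map (e := e), Finset.map_map]
  convert hφ f hf
  ext
  simp

theorem le_minDegree {V : Type*} [Fintype V] [DecidableEq V] {k i c : ℕ}
    {H : UniformHypergraph V k} (hi : i ≤ Fintype.card V)
    (h : ∀ S : Finset V, #S = i → c ≤ H.degree S) : c ≤ H.minDegree i := by
  obtain ⟨S, hS⟩ := Finset.exists_subset_card_eq (s := (univ : Finset V)) hi
  refine le_csInf ⟨H.degree S, S, hS.2, rfl⟩ ?_
  rintro _ ⟨S, hS, rfl⟩
  exact h S hS

theorem minDegree_le {V : Type*} [DecidableEq V] {k : ℕ} (H : UniformHypergraph V k)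
    (S : Finset V) : H.minDegree #S ≤ H.degree S :=
  Nat.sInf_le ⟨S, rfl, rfl⟩

/-- Some `k`-graph on `n` vertices, all of degree at least `c`, has a vertex in no copy of `F`.
The vertex set may be any type, so that each extremal example can use a convenient one. -/
def HasUncovered {W : Type*} {k : ℕ} (F : UniformHypergraph W k) (n c : ℕ) : Prop :=
  ∃ (V : Type) (_ : Fintype V) (_ : DecidableEq V) (H : UniformHypergraph V k) (v : V),
    Fintype.card V = n ∧ (∀ x, c ≤ H.degree {x}) ∧ Avoids F H v

theorem isCoveringThreshold_one {W : Type*} {k n c : ℕ} (hn : 1 ≤ n) {F : UniformHypergraph W k}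
    (hlow : HasUncovered F n c)
    (hup : ∀ (H : UniformHypergraph (Fin n) k) (v : Fin n), (∀ x, c + 1 ≤ H.degree {x}) →
      ¬ Avoids F H v) : F.IsCoveringThreshold 1 n c := by
  have hle : ∀ G : UniformHypergraph (Fin n) k, ¬ F.HasCovering G → G.minDegree 1 ≤ c := by
    intro G hG
    obtain ⟨v, hv⟩ := not_hasCovering_iff.1 hG
    by_contra! hlt
    exact hup G v (fun x => hlt.trans_le (G.minDegree_le {x})) hv
  obtain ⟨V, _, _, H, v, hV, hdeg, hv⟩ := hlow
  let e : V ≃ Fin n := Fintype.equivFinOfCardEq hV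
  have hmap : ¬ F.HasCovering (H.map e) := not_hasCovering_iff.2 ⟨e v, hv.map e⟩
  refine ⟨⟨H.map e, hmap, (hle _ hmap).antisymm ?_⟩, ?_⟩
  · refine le_minDegree (by simpa using hn) fun S hS => ?_
    obtain ⟨x, rfl⟩ := Finset.card_eq_one.1 hS
    simpa [degree_map] using (hdeg (e.symm x)).trans_eq (degree_map e H {e.symm x}).symm
  · rintro _ ⟨G, hG, rfl⟩
    exact hle G hG

end Threshold

section Copies

variable {V : Type*} {H : UniformHypergraph V 3} {v : V}

theorem Avoids.not_isCopy_get {l : List V} {F : UniformHypergraph (Fin l.length) 3}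
    (h : Avoids F H v) (hl : l.Nodup) (hv : v ∈ l) :
    ¬ F.IsCopy H ⟨l.get, List.nodup_iff_injective_get.1 hl⟩ := fun hc =>
  let ⟨i, hi⟩ := List.get_of_mem hv
  h _ hc i hi

variable [DecidableEq V]

theorem isCopy_LP3 {φ : Fin 7 ↪ V} : LP3.IsCopy H φ ↔
    H.IsEdge (φ 0) (φ 1) (φ 2) ∧ H.IsEdge (φ 2) (φ 3) (φ 4) ∧ H.IsEdge (φ 4) (φ 5) (φ 6) := by
  simp [IsCopy, LP3, IsEdge, Finset.map_insert]

theorem isCopy_TP3 {φ : Fin 5 ↪ V} : TP3.IsCopy H φ ↔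
    H.IsEdge (φ 0) (φ 1) (φ 2) ∧ H.IsEdge (φ 1) (φ 2) (φ 3) ∧ H.IsEdge (φ 2) (φ 3) (φ 4) := by
  simp [IsCopy, TP3, IsEdge, Finset.map_insert]

theorem isCopy_GP3 {φ : Fin 6 ↪ V} : GP3.IsCopy H φ ↔
    H.IsEdge (φ 0) (φ 1) (φ 2) ∧ H.IsEdge (φ 1) (φ 2) (φ 3) ∧ H.IsEdge (φ 3) (φ 4) (φ 5) := by
  simp [IsCopy, GP3, IsEdge, Finset.map_insert]

theorem isCopy_K113 {φ : Fin 5 ↪ V} : K113.IsCopy H φ ↔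
    H.IsEdge (φ 0) (φ 1) (φ 2) ∧ H.IsEdge (φ 0) (φ 1) (φ 3) ∧ H.IsEdge (φ 0) (φ 1) (φ 4) := by
  simp [IsCopy, K113, IsEdge, Finset.map_insert]

theorem isCopy_S3 {φ : Fin 7 ↪ V} : S3.IsCopy H φ ↔
    H.IsEdge (φ 0) (φ 1) (φ 2) ∧ H.IsEdge (φ 0) (φ 3) (φ 4) ∧ H.IsEdge (φ 0) (φ 5) (φ 6) := by
  simp [IsCopy, S3, IsEdge, Finset.map_insert]

theorem isCopy_GS3 {φ : Fin 6 ↪ V} : GS3.IsCopy H φ ↔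
    H.IsEdge (φ 0) (φ 1) (φ 2) ∧ H.IsEdge (φ 0) (φ 1) (φ 3) ∧ H.IsEdge (φ 0) (φ 4) (φ 5) := by
  simp [IsCopy, GS3, IsEdge, Finset.map_insert]

variable {a b c d e f g : V}

theorem Avoids.no_LP3 (h : Avoids LP3 H v) (h₁ : H.IsEdge a b c) (h₂ : H.IsEdge c d e)
    (h₃ : H.IsEdge e f g) (hn : [a, b, c, d, e, f, g].Nodup := by grind)
    (hv : v ∈ [a, b, c, d, e, f, g] := by simp) : False :=
  h.not_isCopy_get hn hv (isCopy_LP3.2 ⟨h₁, h₂, h₃⟩)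

theorem Avoids.no_TP3 (h : Avoids TP3 H v) (h₁ : H.IsEdge a b c) (h₂ : H.IsEdge b c d)
    (h₃ : H.IsEdge c d e) (hn : [a, b, c, d, e].Nodup := by grind)
    (hv : v ∈ [a, b, c, d, e] := by simp) : False :=
  h.not_isCopy_get hn hv (isCopy_TP3.2 ⟨h₁, h₂, h₃⟩)

theorem Avoids.no_GP3 (h : Avoids GP3 H v) (h₁ : H.IsEdge a b c) (h₂ : H.IsEdge b c d)
    (h₃ : H.IsEdge d e f) (hn : [a, b, c, d, e, f].Nodup := by grind)
    (hv : v ∈ [a, b, c, d, e, f] := by simp) : False :=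
  h.not_isCopy_get hn hv (isCopy_GP3.2 ⟨h₁, h₂, h₃⟩)

theorem Avoids.no_K113 (h : Avoids K113 H v) (h₁ : H.IsEdge a b c) (h₂ : H.IsEdge a b d)
    (h₃ : H.IsEdge a b e) (hn : [a, b, c, d, e].Nodup := by grind)
    (hv : v ∈ [a, b, c, d, e] := by simp) : False :=
  h.not_isCopy_get hn hv (isCopy_K113.2 ⟨h₁, h₂, h₃⟩)

theorem Avoids.no_S3 (h : Avoids S3 H v) (h₁ : H.IsEdge a b c) (h₂ : H.IsEdge a d e)
    (h₃ : H.IsEdge a f g) (hn : [a, b, c, d, e, f, g].Nodup := by grind)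
    (hv : v ∈ [a, b, c, d, e, f, g] := by simp) : False :=
  h.not_isCopy_get hn hv (isCopy_S3.2 ⟨h₁, h₂, h₃⟩)

theorem Avoids.no_GS3 (h : Avoids GS3 H v) (h₁ : H.IsEdge a b c) (h₂ : H.IsEdge a b d)
    (h₃ : H.IsEdge a e f) (hn : [a, b, c, d, e, f].Nodup := by grind)
    (hv : v ∈ [a, b, c, d, e, f] := by simp) : False :=
  h.not_isCopy_get hn hv (isCopy_GS3.2 ⟨h₁, h₂, h₃⟩)

end Copies

section OfRel

variable {V : Type*} [DecidableEq V] [Fintype V]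

open scoped Classical in
/-- The 3-graph whose edges are the triples of distinct vertices satisfying `R`. It is meant for
relations `R` that are invariant under permutations of their three arguments. -/
noncomputable def ofRel (R : V → V → V → Prop) : UniformHypergraph V 3 where
  edges := {e | ∃ a b c, [a, b, c].Nodup ∧ R a b c ∧ e = {a, b, c}}
  card_of_mem_edges := by
    intro e he
    obtain ⟨a, b, c, habc, -, rfl⟩ := (Finset.mem_filter.1 he).2
    simpa using List.toFinset_card_of_nodup habc

theorem mem_edges_ofRel {R : V → V → V → Prop} {e : Finset V} :
    e ∈ (ofRel R).edges ↔ ∃ a b c, [a, b, c].Nodup ∧ R a b c ∧ e = {a, b, c} := by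
  simp only [ofRel, Finset.mem_filter, Finset.mem_univ, true_and]

theorem isEdge_ofRel {R : V → V → V → Prop} (hswap : ∀ a b c, R a b c → R b a c)
    (hswap' : ∀ a b c, R a b c → R a c b) {a b c : V} :
    (ofRel R).IsEdge a b c ↔ a ≠ b ∧ a ≠ c ∧ b ≠ c ∧ R a b c := by
  constructor
  · intro h
    refine ⟨h.ne.1, h.ne.2.1, h.ne.2.2, ?_⟩
    obtain ⟨x, y, z, -, hR, he⟩ := mem_edges_ofRel.1 h
    have hne := h.ne
    have ha : a ∈ ({x, y, z} : Finset V) := by simp [← he]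
    have hb : b ∈ ({x, y, z} : Finset V) := by simp [← he]
    have hc : c ∈ ({x, y, z} : Finset V) := by simp [← he]
    grind
  · rintro ⟨hab, hac, hbc, hR⟩
    exact mem_edges_ofRel.2 ⟨a, b, c, by simp [*], hR, rfl⟩

theorem card_le_card_nbr {H : UniformHypergraph V 3} {a b : V} {B : Finset V}
    (h : ∀ z ∈ B, H.IsEdge a b z) : #B ≤ #(H.nbr a b) :=
  Finset.card_le_card fun z hz => mem_nbr.2 (h z hz)

theorem le_card_nbr_of_notMem {H : UniformHypergraph V 3} {a b : V} (B : Finset V)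
    (h : ∀ z ∉ B, H.IsEdge a b z) : Fintype.card V - #B ≤ #(H.nbr a b) := by
  rw [← Finset.card_compl]
  exact card_le_card_nbr fun z hz => h z (Finset.mem_compl.1 hz)

end OfRel

section AvoidsOfFn

variable {V : Type*} [DecidableEq V] {H : UniformHypergraph V 3} {v : V}

theorem avoids_TP3 (h : ∀ a b c d e, [a, b, c, d, e].Nodup → H.IsEdge a b c → H.IsEdge b c d →
    H.IsEdge c d e → v ∉ [a, b, c, d, e]) : Avoids TP3 H v := by
  intro φ hφ w hw
  have hmem : v ∈ List.ofFn φ := (List.mem_ofFn ..).2 ⟨w, hw⟩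
  obtain ⟨h₁, h₂, h₃⟩ := isCopy_TP3.1 hφ
  exact h _ _ _ _ _ (List.nodup_ofFn.2 φ.injective) h₁ h₂ h₃ hmem

theorem avoids_K113 (h : ∀ a b c d e, [a, b, c, d, e].Nodup → H.IsEdge a b c → H.IsEdge a b d →
    H.IsEdge a b e → v ∉ [a, b, c, d, e]) : Avoids K113 H v := by
  intro φ hφ w hw
  have hmem : v ∈ List.ofFn φ := (List.mem_ofFn ..).2 ⟨w, hw⟩
  obtain ⟨h₁, h₂, h₃⟩ := isCopy_K113.1 hφ
  exact h _ _ _ _ _ (List.nodup_ofFn.2 φ.injective) h₁ h₂ h₃ hmem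

theorem avoids_S3 (h : ∀ a b c d e f g, [a, b, c, d, e, f, g].Nodup → H.IsEdge a b c →
    H.IsEdge a d e → H.IsEdge a f g → v ∉ [a, b, c, d, e, f, g]) : Avoids S3 H v := by
  intro φ hφ w hw
  have hmem : v ∈ List.ofFn φ := (List.mem_ofFn ..).2 ⟨w, hw⟩
  obtain ⟨h₁, h₂, h₃⟩ := isCopy_S3.1 hφ
  exact h _ _ _ _ _ _ _ (List.nodup_ofFn.2 φ.injective) h₁ h₂ h₃ hmem

theorem avoids_GS3 (h : ∀ a b c d e f, [a, b, c, d, e, f].Nodup → H.IsEdge a b c →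
    H.IsEdge a b d → H.IsEdge a e f → v ∉ [a, b, c, d, e, f]) : Avoids GS3 H v := by
  intro φ hφ w hw
  have hmem : v ∈ List.ofFn φ := (List.mem_ofFn ..).2 ⟨w, hw⟩
  obtain ⟨h₁, h₂, h₃⟩ := isCopy_GS3.1 hφ
  exact h _ _ _ _ _ _ (List.nodup_ofFn.2 φ.injective) h₁ h₂ h₃ hmem

end AvoidsOfFn

section Star

variable {V : Type*} [DecidableEq V] [Fintype V] {o a b c : V}

/-- The 3-graph of all triples through the vertex `o`. -/
noncomputable def star (o : V) : UniformHypergraph V 3 := ofRel fun a b c => a = o ∨ b = o ∨ c = o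

theorem isEdge_star :
    (star o).IsEdge a b c ↔ a ≠ b ∧ a ≠ c ∧ b ≠ c ∧ (a = o ∨ b = o ∨ c = o) :=
  isEdge_ofRel (by tauto) (by tauto)

theorem card_sub_two_le_degree_star (hV : 1 < Fintype.card V) (x : V) :
    Fintype.card V - 2 ≤ (star o).degree {x} := by
  obtain ⟨w, hwx, hw⟩ : ∃ w, w ≠ x ∧ (x = o ∨ w = o) := by
    by_cases hx : x = o
    · obtain ⟨w, hw⟩ := Fintype.exists_ne_of_one_lt_card hV x
      exact ⟨w, hw, .inl hx⟩
    · exact ⟨o, Ne.symm hx, .inr rfl⟩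
  calc Fintype.card V - 2 = Fintype.card V - #{x, w} := by rw [Finset.card_pair hwx.symm]
    _ ≤ #((star o).nbr x w) := le_card_nbr_of_notMem _ (by grind [isEdge_star])
    _ ≤ (star o).degree {x} := card_nbr_le_degree ..

theorem not_isCopy_star {W : Type*} {F : UniformHypergraph W 3} {e f : Finset W}
    (he : e ∈ F.edges) (hf : f ∈ F.edges) (hef : Disjoint e f) (φ : W ↪ V) :
    ¬ F.IsCopy (star o) φ := by
  intro h
  have hmem : ∀ g ∈ F.edges, ∃ i ∈ g, φ i = o := by
    intro g hg
    obtain ⟨a, b, c, -, hR, heq⟩ := mem_edges_ofRel.1 (h g hg)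
    have ho : o ∈ g.map φ := by grind
    simpa using ho
  obtain ⟨i, hi, hio⟩ := hmem e he
  obtain ⟨j, hj, hjo⟩ := hmem f hf
  exact Finset.disjoint_left.1 hef hi (φ.injective (hio.trans hjo.symm) ▸ hj)

theorem hasUncovered_of_disjoint_edges {W : Type*} {F : UniformHypergraph W 3} {e f : Finset W}
    (he : e ∈ F.edges) (hf : f ∈ F.edges) (hef : Disjoint e f) {n : ℕ} (hn : 2 ≤ n) :
    HasUncovered F n (n - 2) :=
  ⟨Fin n, inferInstance, inferInstance, star ⟨0, by lia⟩, ⟨0, by lia⟩, Fintype.card_fin n,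
    fun x => by simpa using card_sub_two_le_degree_star (by simpa using show 1 < n from hn) x,
    fun φ hφ => absurd hφ (not_isCopy_star he hf hef φ)⟩

theorem hasUncovered_LP3 {n : ℕ} (hn : 2 ≤ n) : HasUncovered LP3 n (n - 2) :=
  hasUncovered_of_disjoint_edges (e := {0, 1, 2}) (f := {4, 5, 6}) (by decide) (by decide)
    (by decide) hn

theorem hasUncovered_GP3 {n : ℕ} (hn : 2 ≤ n) : HasUncovered GP3 n (n - 2) :=
  hasUncovered_of_disjoint_edges (e := {0, 1, 2}) (f := {3, 4, 5}) (by decide) (by decide)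
    (by decide) hn

end Star

section Cone

variable {W : Type*} {G : SimpleGraph W} {a b c : W}

/-- The edges of `cone G`. -/
def ConeRel (G : SimpleGraph W) : Option W → Option W → Option W → Prop
  | none, some a, some b | some a, none, some b | some a, some b, none => G.Adj a b
  | some a, some b, some c => ¬ G.Adj a b ∧ ¬ G.Adj a c ∧ ¬ G.Adj b c
  | _, _, _ => False

variable [DecidableEq W] [Fintype W]

/-- The 3-graph on the vertices of `G` and an additional vertex `none`, whose edges are the edges of
`G` joined to `none` and the independent triples of `G`. Thus `G` is the link of `none`, and no
edge off `none` contains an edge of `G`. -/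
noncomputable def cone (G : SimpleGraph W) : UniformHypergraph (Option W) 3 := ofRel (ConeRel G)

theorem isEdge_cone {x y z : Option W} :
    (cone G).IsEdge x y z ↔ x ≠ y ∧ x ≠ z ∧ y ≠ z ∧ ConeRel G x y z := by
  refine isEdge_ofRel ?_ ?_ <;>
    rintro (_ | a) (_ | b) (_ | c) <;> simp only [ConeRel, G.adj_comm] <;> tauto

theorem isEdge_cone_none : (cone G).IsEdge none (some a) (some b) ↔ G.Adj a b := by
  simpa [isEdge_cone, ConeRel] using G.ne_of_adj

theorem isEdge_cone_some : (cone G).IsEdge (some a) (some b) (some c) ↔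
    a ≠ b ∧ a ≠ c ∧ b ≠ c ∧ ¬ G.Adj a b ∧ ¬ G.Adj a c ∧ ¬ G.Adj b c := by
  simp [isEdge_cone, ConeRel]

theorem avoids_TP3_cone (hG : ∀ a b c d, [a, b, c, d].Nodup → G.Adj a b → G.Adj b c →
    ¬ G.Adj c d) : Avoids TP3 (cone G) none := by
  refine avoids_TP3 ?_
  rintro (_ | a) (_ | b) (_ | c) (_ | d) (_ | e) hn h₁ h₂ h₃ hv <;>
    simp_all [isEdge_cone, ConeRel]
  grind

variable [DecidableRel G.Adj]

/-- The vertex `a` together with its neighbours in `G`. -/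
def closedNbr (G : SimpleGraph W) [DecidableRel G.Adj] (a : W) : Finset W :=
  insert a (G.neighborFinset a)

theorem mem_closedNbr : b ∈ closedNbr G a ↔ b = a ∨ G.Adj a b := by
  simp [closedNbr]

theorem card_closedNbr (G : SimpleGraph W) [DecidableRel G.Adj] (a : W) :
    #(closedNbr G a) = G.degree a + 1 := by
  rw [closedNbr, Finset.card_insert_of_notMem (G.notMem_neighborFinset_self a),
    G.card_neighborFinset_eq_degree]

theorem degree_le_card_nbr_cone (G : SimpleGraph W) [DecidableRel G.Adj] (a : W) :
    G.degree a ≤ #((cone G).nbr none (some a)) := by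
  rw [← SimpleGraph.card_neighborFinset_eq_degree, ← Finset.card_map Function.Embedding.some]
  exact card_le_card_nbr (by simp [isEdge_cone_none])

theorem card_sub_card_union_le_card_nbr_cone (hab : b ≠ a) (hadj : ¬ G.Adj a b) :
    Fintype.card W - #(closedNbr G a ∪ closedNbr G b) ≤
      #((cone G).nbr (some a) (some b)) := by
  rw [← Finset.card_compl, ← Finset.card_map Function.Embedding.some]
  refine card_le_card_nbr fun z hz => ?_
  obtain ⟨c, hc, rfl⟩ := Finset.mem_map.1 hz
  simp only [Finset.mem_compl, Finset.mem_union, mem_closedNbr, not_or] at hc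
  exact isEdge_cone_some.2 (by tauto)

theorem le_two_mul_degree_cone_some (G : SimpleGraph W) [DecidableRel G.Adj] (a : W) :
    2 * G.degree a + ∑ b ∈ (closedNbr G a)ᶜ, (Fintype.card W - #(closedNbr G a ∪ closedNbr G b)) ≤
      2 * (cone G).degree {some a} := by
  have hnone : G.degree a ≤ #((cone G).nbr (some a) none) :=
    nbr_comm (cone G) _ _ ▸ degree_le_card_nbr_cone G a
  have hnear : G.degree a ≤ ∑ b ∈ closedNbr G a, #((cone G).nbr (some a) (some b)) := by
    rw [closedNbr, Finset.sum_insert (by simp), ← SimpleGraph.card_neighborFinset_eq_degree,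
      Finset.card_eq_sum_ones]
    refine le_add_left (Finset.sum_le_sum fun b hb => Finset.card_pos.2 ⟨none, mem_nbr.2 ?_⟩)
    exact (isEdge_cone_none.2 <| (G.mem_neighborFinset ..).1 hb).rotate
  have hfar : ∑ b ∈ (closedNbr G a)ᶜ, (Fintype.card W - #(closedNbr G a ∪ closedNbr G b)) ≤
      ∑ b ∈ (closedNbr G a)ᶜ, #((cone G).nbr (some a) (some b)) := by
    refine Finset.sum_le_sum fun b hb => card_sub_card_union_le_card_nbr_cone ?_ ?_ <;>
      simp_all [mem_closedNbr]
  have hsplit := Finset.sum_add_sum_compl (closedNbr G a)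
    fun b => #((cone G).nbr (some a) (some b))
  have hsum := sum_card_nbr (cone G) (some a)
  rw [Fintype.sum_option] at hsum
  lia

theorem le_two_mul_degree_cone_some_of_le {t : ℕ}
    (ht : ∀ b ≠ a, ¬ G.Adj a b → #(closedNbr G a ∪ closedNbr G b) ≤ t) :
    2 * G.degree a + (Fintype.card W - (G.degree a + 1)) * (Fintype.card W - t) ≤
      2 * (cone G).degree {some a} := by
  refine le_trans (Nat.add_le_add_left ?_ _) (le_two_mul_degree_cone_some G a)
  rw [← card_closedNbr, ← Finset.card_compl, ← smul_eq_mul]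
  refine Finset.card_nsmul_le_sum _ _ _ fun b hb => Nat.sub_le_sub_left ?_ _
  rw [Finset.mem_compl, mem_closedNbr, not_or] at hb
  exact ht b hb.1 hb.2

theorem avoids_K113_cone (hG : ∀ a, G.degree a ≤ 2) : Avoids K113 (cone G) none := by
  have hdeg : ∀ a b c d, [b, c, d].Nodup → G.Adj a b → G.Adj a c → ¬ G.Adj a d := by
    intro a b c d hn hb hc hd
    have hcard : #([b, c, d].toFinset) ≤ G.degree a :=
      Finset.card_le_card fun x hx => by simp at hx ⊢; grind
    rw [List.toFinset_card_of_nodup hn] at hcard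
    exact absurd (hcard.trans (hG a)) (by simp)
  refine avoids_K113 ?_
  rintro (_ | a) (_ | b) (_ | c) (_ | d) (_ | e) hn h₁ h₂ h₃ hv <;>
    simp_all [isEdge_cone, ConeRel]
  all_goals grind [G.adj_comm]

end Cone

section ConeExamples

variable {W : Type*} [DecidableEq W] [Fintype W] {G : SimpleGraph W} [DecidableRel G.Adj]
  {a b c : W}

theorem card_closedNbr_union_le (G : SimpleGraph W) [DecidableRel G.Adj] (a b : W) :
    #(closedNbr G a ∪ closedNbr G b) ≤ G.degree a + G.degree b + 2 := by
  have := Finset.card_union_le (closedNbr G a) (closedNbr G b)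
  rw [card_closedNbr, card_closedNbr] at this
  lia

theorem card_closedNbr_union_lt (hac : G.Adj a c) (hbc : G.Adj b c) :
    #(closedNbr G a ∪ closedNbr G b) < G.degree a + G.degree b + 2 := by
  have hinter : 0 < #(closedNbr G a ∩ closedNbr G b) :=
    Finset.card_pos.2 ⟨c, by simp [mem_closedNbr, hac, hbc]⟩
  have := Finset.card_union_add_card_inter (closedNbr G a) (closedNbr G b)
  rw [card_closedNbr, card_closedNbr] at this
  lia

theorem card_le_degree_cone_none (hG : ∀ a, G.degree a = 2) :
    Fintype.card W ≤ (cone G).degree {none} := by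
  have h := card_mul_le_two_mul_degree (S := univ.map Function.Embedding.some)
    (H := cone G) (v := none) (t := 2) (by simpa [hG] using degree_le_card_nbr_cone G)
  rw [Finset.card_map, Finset.card_univ] at h
  lia

theorem card_le_degree_cone_some_of_nine_le (hG : ∀ a, G.degree a = 2)
    (hW : 9 ≤ Fintype.card W) (a : W) : Fintype.card W ≤ (cone G).degree {some a} := by
  have h := le_two_mul_degree_cone_some_of_le (G := G) (a := a) (t := 6)
    fun b _ _ => (card_closedNbr_union_le G a b).trans_eq (by simp [hG])
  obtain ⟨m, hm⟩ := Nat.exists_eq_add_of_le hW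
  simp only [hG, hm, show 9 + m - (2 + 1) = 6 + m by lia,
    show 9 + m - 6 = 3 + m by lia] at h ⊢
  nlinarith

theorem card_le_degree_cone_some_of_common_adj (hG : ∀ a, G.degree a = 2)
    (hW : 8 ≤ Fintype.card W) (hab : b ≠ a) (hadj : ¬ G.Adj a b) (hac : G.Adj a c)
    (hbc : G.Adj b c) : Fintype.card W ≤ (cone G).degree {some a} := by
  have hb : b ∈ (closedNbr G a)ᶜ := by simp [mem_closedNbr, hab, hadj]
  have hlt := card_closedNbr_union_lt hac hbc
  rw [hG, hG] at hlt
  have hsum : ∑ _ ∈ (closedNbr G a)ᶜ, (Fintype.card W - 6) <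
      ∑ z ∈ (closedNbr G a)ᶜ, (Fintype.card W - #(closedNbr G a ∪ closedNbr G z)) :=
    Finset.sum_lt_sum (fun z _ => Nat.sub_le_sub_left
      ((card_closedNbr_union_le G a z).trans_eq (by simp [hG])) _) ⟨b, hb, by lia⟩
  have h := le_two_mul_degree_cone_some G a
  rw [Finset.sum_const, Finset.card_compl, card_closedNbr, hG, smul_eq_mul] at hsum
  obtain ⟨m, hm⟩ := Nat.exists_eq_add_of_le hW
  simp only [hG, hm, show 8 + m - (2 + 1) = 5 + m by lia,
    show 8 + m - 6 = 2 + m by lia] at h hsum ⊢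
  nlinarith

theorem hasUncovered_of_avoids_cone {W : Type} [DecidableEq W] [Fintype W] {V : Type*}
    {F : UniformHypergraph V 3} {G : SimpleGraph W} (hF : Avoids F (cone G) none) {c : ℕ}
    (hnone : c ≤ (cone G).degree {none}) (hsome : ∀ a, c ≤ (cone G).degree {some a}) :
    HasUncovered F (Fintype.card W + 1) c :=
  ⟨Option W, inferInstance, inferInstance, cone G, none, Fintype.card_option,
    Option.forall.2 ⟨hnone, hsome⟩, hF⟩

theorem hasUncovered_TP3 {n : ℕ} (hn : 6 ≤ n) : HasUncovered TP3 n (n - 2) := by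
  obtain ⟨m, rfl⟩ := Nat.exists_eq_add_of_le' hn
  let G : SimpleGraph (Fin (m + 5)) := SimpleGraph.starGraph 0
  have hcenter : G.degree 0 = m + 4 := by simp [G, SimpleGraph.degree_starGraph_center]
  have hleaf : ∀ a ≠ 0, G.degree a = 1 := fun a ha =>
    SimpleGraph.degree_starGraph_of_ne_center ha
  have hsome : ∀ a, m + 4 ≤ (cone G).degree {some a} := by
    intro a
    obtain rfl | ha := eq_or_ne a 0
    · rw [← hcenter]
      exact (degree_le_card_nbr_cone G 0).trans (nbr_comm (cone G) .. ▸ card_nbr_le_degree ..)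
    · have h := le_two_mul_degree_cone_some_of_le (G := G) (a := a) (t := 3) ?_
      · simp only [hleaf a ha, Fintype.card_fin, show m + 5 - (1 + 1) = m + 3 by lia,
          show m + 5 - 3 = m + 2 by lia] at h
        nlinarith
      · intro b hb hadj
        have h0 : b ≠ 0 := by
          rintro rfl
          exact hadj (SimpleGraph.starGraph_adj.2 ⟨hb.symm, .inr rfl⟩)
        have := card_closedNbr_union_lt (G := G) (a := a) (b := b) (c := 0) (by simp [G, ha])
          (by simp [G, h0])
        rw [hleaf a ha, hleaf b h0] at this
        lia
  have hF : Avoids TP3 (cone G) none :=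
    avoids_TP3_cone fun a b c d hn => by simp only [G, SimpleGraph.starGraph_adj]; grind
  simpa using hasUncovered_of_avoids_cone hF
    (hcenter ▸ (degree_le_card_nbr_cone G 0).trans (card_nbr_le_degree ..)) hsome

theorem hasUncovered_TP3_of_modEq_one {k : ℕ} (hk : 3 ≤ k) :
    HasUncovered TP3 (3 * k + 1) (3 * k) := by
  obtain ⟨G, _, hG, hadj⟩ : ∃ (G : SimpleGraph (Fin k × Fin 3)) (_ : DecidableRel G.Adj),
      (∀ a, G.degree a = 2) ∧ ∀ a b, G.Adj a b → a.1 = b.1 :=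
    ⟨⊥ □ ⊤, Classical.decRel _, by simp [SimpleGraph.degree_boxProd],
      by simp +contextual [SimpleGraph.boxProd_adj]⟩
  have hcard : Fintype.card (Fin k × Fin 3) = 3 * k := by simp [mul_comm]
  have hF : Avoids TP3 (cone G) none := by
    refine avoids_TP3_cone fun a b c d hn hab hbc hcd => ?_
    have hsnd : ([a, b, c, d].map Prod.snd).Nodup := by
      refine hn.map_on fun x hx y hy hxy => Prod.ext ?_ hxy
      grind
    simpa using hsnd.length_le_card
  rw [← hcard]
  exact hasUncovered_of_avoids_cone hF (card_le_degree_cone_none hG)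
    (card_le_degree_cone_some_of_nine_le hG (by lia))

theorem hasUncovered_K113 {n : ℕ} (hn : 9 ≤ n) : HasUncovered K113 n (n - 1) := by
  obtain ⟨m, rfl⟩ := Nat.exists_eq_add_of_le' hn
  let G : SimpleGraph (Fin (m + 8)) := SimpleGraph.cycleGraph (m + 8)
  have hG : ∀ a, G.degree a = 2 := fun a => SimpleGraph.cycleGraph_degree_three_le
  have h2 : (1 : Fin (m + 8)) + 1 ≠ 0 := by
    simp [Fin.ext_iff, Fin.val_add, Nat.mod_eq_of_lt (show 2 < m + 8 by lia)]
  have h3 : (-1 : Fin (m + 8)) + -1 ≠ 1 := by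
    rw [← neg_add, Ne, neg_eq_iff_add_eq_zero]
    simp [Fin.ext_iff, Fin.val_add, Nat.mod_eq_of_lt (show 3 < m + 8 by lia)]
  have hsome : ∀ a, Fintype.card (Fin (m + 8)) ≤ (cone G).degree {some a} := fun a =>
    card_le_degree_cone_some_of_common_adj (b := a + 1 + 1) (c := a + 1) hG (by simp)
      (by simpa [add_assoc] using h2)
      (by simpa [G, SimpleGraph.cycleGraph_adj, add_assoc] using h3)
      (by simp [G, SimpleGraph.cycleGraph_adj]) (by simp [G, SimpleGraph.cycleGraph_adj])
  simpa using hasUncovered_of_avoids_cone (avoids_K113_cone fun a => (hG a).le)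
    (card_le_degree_cone_none hG) hsome

end ConeExamples

section Pivot

variable {V : Type*} [DecidableEq V] [Fintype V] {v w x y a b c : V}

/-- The 3-graph with base `v` and pivot `w` consisting of all triples through `w` missing `v`, and
all triples through `v` missing `w` that contain `x` or `y`. It has no copy of `S3` through `v`. -/
noncomputable def pivotGraph (v w x y : V) : UniformHypergraph V 3 :=
  ofRel fun a b c => let e : Finset V := {a, b, c}
    (w ∈ e ∧ v ∉ e) ∨ (v ∈ e ∧ w ∉ e ∧ (x ∈ e ∨ y ∈ e))

theorem isEdge_pivotGraph : (pivotGraph v w x y).IsEdge a b c ↔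
    a ≠ b ∧ a ≠ c ∧ b ≠ c ∧ (((a = w ∨ b = w ∨ c = w) ∧ a ≠ v ∧ b ≠ v ∧ c ≠ v) ∨
      ((a = v ∨ b = v ∨ c = v) ∧ a ≠ w ∧ b ≠ w ∧ c ≠ w ∧
        (a = x ∨ b = x ∨ c = x ∨ a = y ∨ b = y ∨ c = y))) := by
  rw [pivotGraph, isEdge_ofRel (by grind) (by grind)]
  grind

theorem avoids_S3_pivotGraph (hvx : v ≠ x) (hvy : v ≠ y) : Avoids S3 (pivotGraph v w x y) v := by
  refine avoids_S3 fun a b c d e f g hn h₁ h₂ h₃ hv => ?_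
  rw [isEdge_pivotGraph] at h₁ h₂ h₃
  obtain rfl | hav := eq_or_ne a v
  · grind
  · grind

theorem card_sub_three_le_card_nbr_pivot (hav : a ≠ v) (haw : a ≠ w) (hvw : v ≠ w) :
    Fintype.card V - 3 ≤ #((pivotGraph v w x y).nbr a w) :=
  (Nat.sub_le_sub_left Finset.card_le_three _).trans
    (le_card_nbr_of_notMem {a, w, v} (by grind [isEdge_pivotGraph]))

theorem card_sub_three_le_card_nbr_base (hvw : v ≠ w) (hav : a ≠ v) (haw : a ≠ w)
    (ha : a = x ∨ a = y) : Fintype.card V - 3 ≤ #((pivotGraph v w x y).nbr a v) :=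
  (Nat.sub_le_sub_left Finset.card_le_three _).trans
    (le_card_nbr_of_notMem {a, v, w} (by grind [isEdge_pivotGraph]))

theorem card_sub_one_le_degree_pivotGraph (hV : 6 ≤ Fintype.card V) (hn : [v, w, x, y].Nodup)
    (a : V) : Fintype.card V - 1 ≤ (pivotGraph v w x y).degree {a} := by
  have hvw : v ≠ w := by grind
  have hxy : x ≠ y := by grind
  obtain rfl | hav := eq_or_ne a v
  · have hx := card_sub_three_le_card_nbr_base hvw (a := x) (x := x) (y := y) (by grind)
      (by grind) (.inl rfl)
    have hy := card_sub_three_le_card_nbr_base hvw (a := y) (x := x) (y := y) (by grind)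
      (by grind) (.inr rfl)
    rw [nbr_comm] at hx hy
    have hsum := card_nbr_add_card_nbr_le (pivotGraph a w x y) a hxy
    grind
  obtain rfl | haw := eq_or_ne a w
  · have hx := card_sub_three_le_card_nbr_pivot (a := x) (x := x) (y := y) (v := v)
      (w := a) (by grind) (by grind) hvw
    have hy := card_sub_three_le_card_nbr_pivot (a := y) (x := x) (y := y) (v := v)
      (w := a) (by grind) (by grind) hvw
    rw [nbr_comm] at hx hy
    have hsum := card_nbr_add_card_nbr_le (pivotGraph v a x y) a hxy
    grind
  have hw := card_sub_three_le_card_nbr_pivot (x := x) (y := y) hav haw hvw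
  have hv : 2 ≤ #((pivotGraph v w x y).nbr a v) := by
    by_cases ha : a = x ∨ a = y
    · exact le_trans (by lia) (card_sub_three_le_card_nbr_base hvw hav haw ha)
    · rw [← Finset.card_pair hxy]
      exact card_le_card_nbr (by grind [isEdge_pivotGraph])
  have hsum := card_nbr_add_card_nbr_le (pivotGraph v w x y) a hvw.symm
  rw [if_neg (by grind [isEdge_pivotGraph])] at hsum
  lia

theorem hasUncovered_S3 {n : ℕ} (hn : 6 ≤ n) : HasUncovered S3 n (n - 1) := by
  obtain ⟨m, rfl⟩ := Nat.exists_eq_add_of_le (show 4 ≤ n by lia)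
  have hcard : Fintype.card (Fin 4 ⊕ Fin m) = 4 + m := by simp
  exact ⟨Fin 4 ⊕ Fin m, inferInstance, inferInstance,
    pivotGraph (.inl 0) (.inl 1) (.inl 2) (.inl 3), .inl 0, hcard,
    fun a => hcard ▸ card_sub_one_le_degree_pivotGraph (by lia) (by simp) a,
    avoids_S3_pivotGraph (by simp) (by simp)⟩

end Pivot

section Apex

/-- The edges of `apexGraph k`. -/
def ApexRel (k : ℕ) : Bool ⊕ ZMod k ⊕ ZMod k → Bool ⊕ ZMod k ⊕ ZMod k →
    Bool ⊕ ZMod k ⊕ ZMod k → Prop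
  | .inl _, .inl _, .inr (.inl _) | .inl _, .inr (.inl _), .inl _
  | .inr (.inl _), .inl _, .inl _ => True
  | .inr (.inl i), .inr (.inl j), .inr (.inr l) | .inr (.inl i), .inr (.inr l), .inr (.inl j)
  | .inr (.inr l), .inr (.inl i), .inr (.inl j) => i + j = l
  | .inr (.inr _), .inr (.inr _), .inr (.inr _) => True
  | _, _, _ => False

variable {k : ℕ} [NeZero k]

/-- The 3-graph on two apices and on a left and a right copy of `ZMod k`, whose edges are the
triples of both apices and a left vertex, of two left vertices and the right vertex at their sum,
and of three right vertices. It has no copy of `GS3` through an apex. -/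
noncomputable def apexGraph (k : ℕ) [NeZero k] : UniformHypergraph (Bool ⊕ ZMod k ⊕ ZMod k) 3 :=
  ofRel (ApexRel k)

theorem isEdge_apexGraph {a b c : Bool ⊕ ZMod k ⊕ ZMod k} :
    (apexGraph k).IsEdge a b c ↔ a ≠ b ∧ a ≠ c ∧ b ≠ c ∧ ApexRel k a b c := by
  refine isEdge_ofRel ?_ ?_ <;>
    rintro (_ | _ | _) (_ | _ | _) (_ | _ | _) <;> simp [ApexRel, add_comm]

theorem mem_of_isEdge_apexGraph_inl {x : Bool} {b c : Bool ⊕ ZMod k ⊕ ZMod k}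
    (h : (apexGraph k).IsEdge (.inl x) b c) : b = .inl (!x) ∨ c = .inl (!x) := by
  rw [isEdge_apexGraph] at h
  rcases b with (y | _ | _) <;> rcases c with (z | _ | _) <;> cases x <;> simp_all [ApexRel]

theorem eq_of_isEdge_apexGraph_left {i : ZMod k} {b c d : Bool ⊕ ZMod k ⊕ ZMod k}
    (hc : (apexGraph k).IsEdge (.inr (.inl i)) b c)
    (hd : (apexGraph k).IsEdge (.inr (.inl i)) b d) : c = d := by
  rw [isEdge_apexGraph] at hc hd
  rcases b with (x | _ | _) <;> rcases c with (y | _ | _) <;> rcases d with (z | _ | _) <;>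
    simp_all [ApexRel]
  · cases x <;> cases y <;> cases z <;> simp_all
  · grind

theorem not_isEdge_apexGraph_right_inl {l : ZMod k} {x : Bool} {b : Bool ⊕ ZMod k ⊕ ZMod k} :
    ¬ (apexGraph k).IsEdge (.inr (.inr l)) (.inl x) b := by
  rw [isEdge_apexGraph]
  rcases b with (_ | _ | _) <;> simp [ApexRel]

theorem avoids_GS3_apexGraph (x : Bool) : Avoids GS3 (apexGraph k) (.inl x) := by
  refine avoids_GS3 ?_
  rintro (y | i | l) b c d e f hn h₁ h₂ h₃ hv
  · grind [mem_of_isEdge_apexGraph_inl h₁, mem_of_isEdge_apexGraph_inl h₂,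
      mem_of_isEdge_apexGraph_inl h₃]
  · grind [eq_of_isEdge_apexGraph_left h₁ h₂]
  · have hright : ∀ b c, (apexGraph k).IsEdge (.inr (.inr l)) b c → b ≠ .inl x ∧ c ≠ .inl x := by
      refine fun b c h => ⟨?_, ?_⟩ <;> rintro rfl
      exacts [not_isEdge_apexGraph_right_inl h, not_isEdge_apexGraph_right_inl h.swap_right]
    grind [hright _ _ h₁, hright _ _ h₂, hright _ _ h₃]

theorem le_card_nbr_apexGraph_inl (x : Bool) :
    k ≤ #((apexGraph k).nbr (.inl x) (.inl (!x))) := by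
  let left : ZMod k ↪ Bool ⊕ ZMod k ⊕ ZMod k := .trans .inl .inr
  calc k = #(univ.map left) := by simp [ZMod.card]
    _ ≤ _ := card_le_card_nbr (by simp [left, isEdge_apexGraph, ApexRel])

theorem le_degree_apexGraph_left (i : ZMod k) : k ≤ (apexGraph k).degree {.inr (.inl i)} := by
  let B : Finset (Bool ⊕ ZMod k ⊕ ZMod k) := {.inr (.inl i), .inr (.inr (i + i))}
  have hB : #Bᶜ = 2 * k := by
    rw [Finset.card_compl, Finset.card_pair (by simp)]
    simp [ZMod.card]
    lia
  have h : #Bᶜ * 1 ≤ 2 * (apexGraph k).degree {.inr (.inl i)} := by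
    refine card_mul_le_two_mul_degree fun z hz => Finset.card_pos.2 ?_
    simp only [B, Finset.mem_compl, Finset.mem_insert, Finset.mem_singleton, not_or] at hz
    simp only [Finset.Nonempty, mem_nbr]
    rcases z with (x | j | l)
    · exact ⟨.inl (!x), by simp [isEdge_apexGraph, ApexRel]⟩
    · exact ⟨.inr (.inr (i + j)), by simp_all [isEdge_apexGraph, ApexRel, eq_comm]⟩
    · exact ⟨.inr (.inl (l - i)), by
        simp_all [isEdge_apexGraph, ApexRel, eq_sub_iff_add_eq, eq_comm]⟩
  lia

theorem le_degree_apexGraph_right (hk : 5 ≤ k) (l : ZMod k) :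
    k ≤ (apexGraph k).degree {.inr (.inr l)} := by
  let right : ZMod k ↪ Bool ⊕ ZMod k ⊕ ZMod k := .trans .inr .inr
  have hnbr : ∀ z ∈ (univ.erase l).map right, k - 2 ≤ #((apexGraph k).nbr (right l) z) := by
    simp only [Finset.mem_map, Finset.mem_erase, Finset.mem_univ, and_true]
    rintro _ ⟨j, hj, rfl⟩
    calc k - 2 = #(({l, j} : Finset (ZMod k))ᶜ.map right) := by
          rw [Finset.card_map, Finset.card_compl, Finset.card_pair hj.symm, ZMod.card]
      _ ≤ _ := card_le_card_nbr (by
          simp [right, isEdge_apexGraph, ApexRel]; grind)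
  have h := card_mul_le_two_mul_degree hnbr
  rw [Finset.card_map, Finset.card_erase_of_mem (Finset.mem_univ l), Finset.card_univ,
    ZMod.card] at h
  obtain ⟨m, rfl⟩ := Nat.exists_eq_add_of_le' hk
  simp only [show m + 5 - 1 = m + 4 by lia, show m + 5 - 2 = m + 3 by lia] at h
  exact (by nlinarith : m + 5 ≤ (apexGraph (m + 5)).degree {right l})

theorem hasUncovered_GS3_of_even (hk : 5 ≤ k) : HasUncovered GS3 (2 * k + 2) k := by
  refine ⟨_, inferInstance, inferInstance, apexGraph k, .inl true, ?_, ?_,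
    avoids_GS3_apexGraph true⟩
  · simp [ZMod.card]
    lia
  · rintro (x | i | l)
    · exact (le_card_nbr_apexGraph_inl x).trans (card_nbr_le_degree ..)
    · exact le_degree_apexGraph_left i
    · exact le_degree_apexGraph_right hk l

end Apex

section Paired

/-- The edges of `pairedGraph A p`. -/
def PairedRel (A : Type) [AddCommGroup A] (p : ℕ) : {a : A // a ≠ 0} ⊕ Fin p × Bool →
    {a : A // a ≠ 0} ⊕ Fin p × Bool → {a : A // a ≠ 0} ⊕ Fin p × Bool → Prop
  | .inl a, .inl b, .inl c => a.1 + b.1 + c.1 = 0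
  | .inl _, .inr x, .inr y | .inr x, .inl _, .inr y | .inr x, .inr y, .inl _ => x.1 = y.1
  | _, _, _ => False

variable {A : Type} [AddCommGroup A] [Fintype A] [DecidableEq A] {p : ℕ}

/-- The 3-graph on the nonzero elements of a group `A` and on `p` disjoint pairs of further
vertices, whose edges are the triples of group elements with sum `0` and the triples of a pair and
a group element. It has no copy of `GS3` at all. -/
noncomputable def pairedGraph (A : Type) [AddCommGroup A] [Fintype A] [DecidableEq A] (p : ℕ) :
    UniformHypergraph ({a : A // a ≠ 0} ⊕ Fin p × Bool) 3 :=
  ofRel (PairedRel A p)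

theorem isEdge_pairedGraph {a b c : {a : A // a ≠ 0} ⊕ Fin p × Bool} :
    (pairedGraph A p).IsEdge a b c ↔ a ≠ b ∧ a ≠ c ∧ b ≠ c ∧ PairedRel A p a b c := by
  refine isEdge_ofRel ?_ ?_
  · rintro (a | a) (b | b) (c | c) <;> simp only [PairedRel, imp_self, eq_comm, add_comm b.1]
  · rintro (a | a) (b | b) (c | c) <;>
      simp only [PairedRel, imp_self, eq_comm, add_right_comm _ b.1]

theorem isEdge_pairedGraph_inr {x : Fin p × Bool} {b c : {a : A // a ≠ 0} ⊕ Fin p × Bool} :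
    (pairedGraph A p).IsEdge (.inr x) b c ↔
      (b = .inr (x.1, !x.2) ∧ c.isLeft) ∨ (c = .inr (x.1, !x.2) ∧ b.isLeft) := by
  rw [isEdge_pairedGraph]
  obtain ⟨i, s⟩ := x
  rcases b with (b | ⟨j, t⟩) <;> rcases c with (c | ⟨l, u⟩) <;> simp [PairedRel] <;>
    cases s <;> grind

theorem eq_of_isEdge_pairedGraph_inl {a : {a : A // a ≠ 0}}
    {b c d : {a : A // a ≠ 0} ⊕ Fin p × Bool} (hc : (pairedGraph A p).IsEdge (.inl a) b c)
    (hd : (pairedGraph A p).IsEdge (.inl a) b d) : c = d := by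
  rcases b with (b | y)
  · have hc := (isEdge_pairedGraph.1 hc).2.2.2
    have hd := (isEdge_pairedGraph.1 hd).2.2.2
    rcases c with (c | _) <;> rcases d with (d | _) <;> simp only [PairedRel] at hc hd
    exact congrArg Sum.inl <| Subtype.ext <| add_left_cancel <| hc.trans hd.symm
  · have hc := isEdge_pairedGraph_inr.1 hc.swap
    have hd := isEdge_pairedGraph_inr.1 hd.swap
    grind

theorem avoids_GS3_pairedGraph (v : {a : A // a ≠ 0} ⊕ Fin p × Bool) :
    Avoids GS3 (pairedGraph A p) v := by
  refine avoids_GS3 ?_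
  rintro (a | x) b c d e f hn h₁ h₂ h₃
  · grind [eq_of_isEdge_pairedGraph_inl h₁ h₂]
  · rw [isEdge_pairedGraph_inr] at h₁ h₂ h₃
    grind

theorem exists_isEdge_pairedGraph_inl (h2 : ∀ a : A, a + a = 0) {a : {a : A // a ≠ 0}}
    {z : {a : A // a ≠ 0} ⊕ Fin p × Bool} (hz : z ≠ .inl a) :
    ∃ y, (pairedGraph A p).IsEdge (.inl a) z y := by
  rcases z with (b | x)
  · have hab : a.1 ≠ b.1 := fun hab => hz (by rw [Subtype.ext hab])
    have hsum : a.1 + b.1 ≠ 0 := fun hsum => hab (add_right_cancel (hsum.trans (h2 b).symm))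
    exact ⟨.inl ⟨a + b, hsum⟩, by
      simp [isEdge_pairedGraph, PairedRel, h2, Subtype.ext_iff, hab, a.2, b.2]⟩
  · exact ⟨.inr (x.1, !x.2), (isEdge_pairedGraph_inr.2 (by simp)).swap⟩

omit [DecidableEq A] in
theorem hasUncovered_GS3_paired {q : ℕ} (hA : Fintype.card A = 2 * q) (hq : 1 ≤ q) (hp : p ≤ q)
    (h2 : ∀ a : A, a + a = 0) : HasUncovered GS3 (2 * (q + p) - 1) (q + p - 1) := by
  classical
  have hA₀ : Fintype.card {a : A // a ≠ 0} = 2 * q - 1 := by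
    rw [Fintype.card_subtype_compl, Fintype.card_subtype_eq, hA]
  have hV : Fintype.card ({a : A // a ≠ 0} ⊕ Fin p × Bool) = 2 * (q + p) - 1 := by
    simp only [Fintype.card_sum, hA₀, Fintype.card_prod, Fintype.card_fin, Fintype.card_bool]
    lia
  obtain ⟨v⟩ : Nonempty ({a : A // a ≠ 0} ⊕ Fin p × Bool) := by
    rw [← Fintype.card_pos_iff]
    lia
  refine ⟨_, inferInstance, inferInstance, pairedGraph A p, v, hV, ?_, avoids_GS3_pairedGraph v⟩
  rintro (a | x)
  · have hnbr : ∀ z ∈ univ.erase (.inl a), 1 ≤ #((pairedGraph A p).nbr (.inl a) z) := by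
      refine fun z hz => Finset.card_pos.2 ?_
      obtain ⟨y, hy⟩ := exists_isEdge_pairedGraph_inl h2 (Finset.ne_of_mem_erase hz)
      exact ⟨y, mem_nbr.2 hy⟩
    have h := card_mul_le_two_mul_degree hnbr
    rw [Finset.card_erase_of_mem (Finset.mem_univ _), Finset.card_univ, hV] at h
    lia
  · let inl : {a : A // a ≠ 0} ↪ {a : A // a ≠ 0} ⊕ Fin p × Bool := .inl
    calc q + p - 1 ≤ #(univ.map inl) := by
          rw [Finset.card_map, Finset.card_univ, hA₀]
          lia
      _ ≤ #((pairedGraph A p).nbr (.inr x) (.inr (x.1, !x.2))) :=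
          card_le_card_nbr (by simp [inl, isEdge_pairedGraph_inr])
      _ ≤ _ := card_nbr_le_degree ..

theorem hasUncovered_GS3 {n : ℕ} (hn : 13 ≤ n) : HasUncovered GS3 n ((n - 1) / 2) := by
  rcases n.even_or_odd' with ⟨k, rfl | rfl⟩
  · have : NeZero (k - 1) := ⟨by lia⟩
    convert hasUncovered_GS3_of_even (k := k - 1) (by lia) using 1 <;> lia
  · have hle : 2 ^ Nat.log 2 (k + 1) ≤ k + 1 := Nat.pow_log_le_self 2 (by lia)
    have hlt : k + 1 < 2 ^ (Nat.log 2 (k + 1) + 1) := Nat.lt_pow_succ_log_self (by simp) _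
    rw [pow_succ] at hlt
    convert hasUncovered_GS3_paired (A := Fin (Nat.log 2 (k + 1) + 1) → ZMod 2)
      (q := 2 ^ Nat.log 2 (k + 1)) (p := k + 1 - 2 ^ Nat.log 2 (k + 1))
      (by simp [ZMod.card, pow_succ, mul_comm]) Nat.one_le_two_pow (by lia)
      (fun a => CharTwo.add_self_eq_zero a) using 1 <;> lia

end Paired

section K113

variable {V : Type*} [DecidableEq V] [Fintype V] {H : UniformHypergraph V 3} {v : V}

theorem degree_lt_card_of_avoids_K113 (h : Avoids K113 H v) : H.degree {v} < Fintype.card V := by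
  have hcodeg : ∀ x ≠ v, #(H.nbr v x) ≤ 2 := by
    intro x _
    by_contra! hlt
    obtain ⟨c, hc, d, hd, e, he, hcd, hce, hde⟩ := Finset.two_lt_card.1 hlt
    rw [mem_nbr] at hc hd he
    exact h.no_K113 hc hd he
  have hdeg := two_mul_degree_le hcodeg
  have hpos : 0 < Fintype.card V := Fintype.card_pos_iff.2 ⟨v⟩
  lia

theorem isCoveringThreshold_K113 {n : ℕ} (hn : 9 ≤ n) : K113.IsCoveringThreshold 1 n (n - 1) := by
  refine isCoveringThreshold_one (by lia) (hasUncovered_K113 hn) fun H v hdeg h => ?_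
  have hlt := degree_lt_card_of_avoids_K113 h
  rw [Fintype.card_fin] at hlt
  have := hdeg v
  lia

end K113

section GS3

variable {V : Type*} [DecidableEq V] [Fintype V] {H : UniformHypergraph V 3} {v : V}

theorem eq_or_eq_of_four_le_card_nbr {x : V} (hx : 4 ≤ #(H.nbr v x))
    (h : ∀ a b p q, H.IsEdge v x a → H.IsEdge v x b → H.IsEdge v p q → ¬ [x, a, b, p, q].Nodup) :
    ∀ p q, H.IsEdge v p q → p = x ∨ q = x := by
  intro p q hpq
  by_contra! hne
  obtain ⟨a, b, hab, ha, hb, hxa, hxb⟩ := exists_two_isEdge_notMem (S := {p, q})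
    ((Nat.succ_le_succ Finset.card_le_two).trans_lt hx)
  exact h a b p q hxa hxb hpq (by grind)

theorem card_nbr_le_one_of_card_nbr_le_three (hdeg : 7 ≤ H.degree {v})
    (hcodeg : ∀ x, #(H.nbr v x) ≤ 3)
    (h : ∀ a x y p q, H.IsEdge v a x → H.IsEdge v a y → H.IsEdge v p q →
      ¬ [a, x, y, p, q].Nodup) (b : V) : #(H.nbr v b) ≤ 1 := by
  by_contra! hb
  obtain ⟨a, c, ha, hc, hac⟩ := Finset.one_lt_card_iff.1 hb
  rw [mem_nbr] at ha hc
  have hoff : #(H.linkOff v {c, a, b}) = 0 := card_linkOff_eq_zero fun p q hpq hp => by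
    grind [h b a c p q ha hc hpq]
  have hbound : H.degree {v} ≤ #(H.nbr v b) + #(H.nbr v a \ {b}) + #(H.nbr v c \ {a, b}) := by
    have := degree_le_card_nbr_add H v b
    have := card_linkOff_le_add H v {b} a
    have := card_linkOff_le_add H v {a, b} c
    lia
  have hcodegb := hcodeg b
  have hcodega := hcodeg a
  have hcodegc := hcodeg c
  have hnbra : #(H.nbr v a \ {b}) + 1 ≤ #(H.nbr v a) :=
    Finset.card_lt_card <| Finset.sdiff_ssubset (by simpa using ha.swap_right) (by simp)
  have hnbrc : #(H.nbr v c \ {a, b}) + 1 ≤ #(H.nbr v c) := Finset.card_lt_card <|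
    Finset.ssubset_iff_subset_ne.2 ⟨Finset.sdiff_subset, by grind [mem_nbr, hc.swap_right]⟩
  have hca : ¬ H.IsEdge v a c := by
    intro hac'
    have : #(H.nbr v c \ {a, b}) = #(H.nbr v c) - 2 := by
      rw [Finset.card_sdiff_of_subset, Finset.card_pair ha.ne.2.2.symm]
      simp [Finset.insert_subset_iff, hac'.swap_right, hc.swap_right]
    lia
  obtain ⟨p, q, hp, hq, hpq⟩ := Finset.one_lt_card_iff.1 (by lia : 1 < #(H.nbr v a \ {b}))
  simp only [Finset.mem_sdiff, mem_nbr, Finset.mem_singleton] at hp hq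
  specialize h a p q b c hp.1 hq.1 hc
  grind

theorem link_star_or_matching (hdeg : 7 ≤ H.degree {v})
    (h : ∀ a x y p q, H.IsEdge v a x → H.IsEdge v a y → H.IsEdge v p q →
      ¬ [a, x, y, p, q].Nodup) :
    (∃ x, ∀ p q, H.IsEdge v p q → p = x ∨ q = x) ∨ ∀ x, #(H.nbr v x) ≤ 1 := by
  by_cases! hx : ∃ x, 4 ≤ #(H.nbr v x)
  · exact .inl <| hx.imp fun x hx => eq_or_eq_of_four_le_card_nbr hx (h x)
  · exact .inr <| card_nbr_le_one_of_card_nbr_le_three hdeg (fun x => Nat.lt_succ_iff.1 (hx x)) h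

theorem card_nbr_le_one_of_forall_eq_or_eq {x y : V} (h : Avoids GS3 H v)
    (hv : ∀ p q, H.IsEdge v p q → p = x ∨ q = x) (hx : ∀ p q, H.IsEdge x p q → p = v ∨ q = v)
    (hy : H.IsEdge v x y) (z : V) : #(H.nbr y z) ≤ 1 := by
  have hmeet : ∀ q, H.IsEdge y z q → (z = v ∨ q = v ↔ z = x ∨ q = x) := by
    grind [IsEdge.swap, IsEdge.swap_right]
  refine Finset.card_le_one.2 fun c hc d hd => ?_
  rw [mem_nbr] at hc hd
  have hmeetc := hmeet c hc
  have hmeetd := hmeet d hd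
  clear hv hx hmeet
  by_contra hcd
  exact h.no_GS3 hc hd hy.rotate.rotate

theorem exists_two_mul_degree_lt_of_avoids_GS3 (hdeg : 7 ≤ H.degree {v}) (h : Avoids GS3 H v) :
    ∃ y, 2 * H.degree {y} < Fintype.card V := by
  have hpos : 0 < Fintype.card V := Fintype.card_pos_iff.2 ⟨v⟩
  suffices ∃ y, ∀ z, #(H.nbr y z) ≤ 1 by
    obtain ⟨y, hy⟩ := this
    have := two_mul_degree_le fun z (_ : z ≠ y) => hy z
    exact ⟨y, by lia⟩
  have hlink : ∀ a x y p q, H.IsEdge v a x → H.IsEdge v a y → H.IsEdge v p q →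
      ¬ [a, x, y, p, q].Nodup := fun a x y p q hx hy hpq hn => h.no_GS3 hx hy hpq
  obtain ⟨x, hx⟩ | hmatch := link_star_or_matching hdeg hlink
  · have hnbr : 7 ≤ #(H.nbr v x) := hdeg.trans (degree_le_card_nbr hx)
    have hx' : ∀ p q, H.IsEdge x p q → p = v ∨ q = v :=
      eq_or_eq_of_four_le_card_nbr (by rw [nbr_comm]; lia)
        fun a b p q ha hb hpq hn => h.no_GS3 ha hb hpq
    obtain ⟨y, hy⟩ := Finset.card_pos.1 (by lia : 0 < #(H.nbr v x))
    rw [mem_nbr] at hy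
    exact ⟨y, card_nbr_le_one_of_forall_eq_or_eq h hx hx' hy⟩
  · exact ⟨v, hmatch⟩

theorem isCoveringThreshold_GS3 {n : ℕ} (hn : 13 ≤ n) :
    GS3.IsCoveringThreshold 1 n ((n - 1) / 2) := by
  refine isCoveringThreshold_one (by lia) (hasUncovered_GS3 hn) fun H v hdeg h => ?_
  obtain ⟨y, hy⟩ := exists_two_mul_degree_lt_of_avoids_GS3 (by grind) h
  rw [Fintype.card_fin] at hy
  have := hdeg y
  lia

end GS3

section TP3

variable {V : Type*} [DecidableEq V] {H : UniformHypergraph V 3} {v : V}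

theorem Avoids.no_path_TP3 {a b c d : V} (h : Avoids TP3 H v) (h₁ : H.IsEdge v a b)
    (h₂ : H.IsEdge v b c) (h₃ : H.IsEdge v c d) (hac : a ≠ c) (had : a ≠ d) (hbd : b ≠ d) : False :=
  h.no_TP3 h₁.rotate h₂.swap h₃

variable [Fintype V]

theorem card_nbr_eq_one_of_three_le {x y : V} (h : Avoids TP3 H v) (hx : 3 ≤ #(H.nbr v x))
    (hxy : H.IsEdge v x y) : #(H.nbr v y) = 1 := by
  refine Finset.card_eq_one.2 ⟨x, Finset.eq_singleton_iff_unique_mem.2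
    ⟨mem_nbr.2 hxy.swap_right, fun z hz => ?_⟩⟩
  rw [mem_nbr] at hz
  by_contra hzx
  obtain ⟨w, hw, hxw⟩ := exists_isEdge_notMem (S := {y, z}) (Finset.card_le_two.trans_lt hx)
  exact h.no_path_TP3 hxw.swap_right hxy hz (by grind) (by grind) (Ne.symm hzx)

theorem sum_card_nbr_three_le (h : Avoids TP3 H v) :
    ∑ x ∈ univ.erase v with 3 ≤ #(H.nbr v x), #(H.nbr v x) ≤
      #{y ∈ univ.erase v | #(H.nbr v y) = 1} := by
  rw [← Finset.card_biUnion]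
  · refine Finset.card_le_card fun y hy => ?_
    obtain ⟨x, hx, hxy⟩ := Finset.mem_biUnion.1 hy
    rw [mem_nbr] at hxy
    exact Finset.mem_filter.2 ⟨by simpa using hxy.ne.2.1.symm,
      card_nbr_eq_one_of_three_le h (Finset.mem_filter.1 hx).2 hxy⟩
  · intro x hx y _ hxy
    rw [Function.onFun, Finset.disjoint_left]
    intro z hz hz'
    rw [mem_nbr] at hz hz'
    have hle := (card_nbr_eq_one_of_three_le h (Finset.mem_filter.1 hx).2 hz).le
    exact hxy <| Finset.card_le_one.1 hle _ (mem_nbr.2 hz.swap_right) _ (mem_nbr.2 hz'.swap_right)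

theorem card_nbr_le_two_of_avoids_TP3 (h : Avoids TP3 H v)
    (hdeg : Fintype.card V - 1 ≤ H.degree {v}) {x : V} (hx : x ≠ v) : #(H.nbr v x) ≤ 2 := by
  have hpoint : ∀ y ∈ univ.erase v,
      #(H.nbr v y) + (if 3 ≤ #(H.nbr v y) then 2 else 0) + (if #(H.nbr v y) = 1 then 1 else 0) ≤
        2 + if 3 ≤ #(H.nbr v y) then #(H.nbr v y) else 0 := by
    intro y _
    split_ifs <;> lia
  have hsum := Finset.sum_le_sum hpoint
  simp only [Finset.sum_add_distrib, ← Finset.sum_filter, Finset.sum_const, smul_eq_mul, mul_one,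
    Finset.card_erase_of_mem (Finset.mem_univ v), Finset.card_univ, sum_erase_card_nbr] at hsum
  have hleaf := sum_card_nbr_three_le h
  have hbig : #{y ∈ univ.erase v | 3 ≤ #(H.nbr v y)} = 0 := by lia
  by_contra! hlt
  have hmem : x ∈ ({y ∈ univ.erase v | 3 ≤ #(H.nbr v y)} : Finset V) := by
    simpa [hx, Nat.succ_le_iff] using hlt
  simp [Finset.card_eq_zero.1 hbig] at hmem

theorem degree_lt_card_of_avoids_TP3 (h : Avoids TP3 H v) : H.degree {v} < Fintype.card V := by
  by_contra! hlt
  have hpos : 0 < Fintype.card V := Fintype.card_pos_iff.2 ⟨v⟩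
  have := two_mul_degree_le fun x => card_nbr_le_two_of_avoids_TP3 h (by lia) (x := x)
  lia

variable (h : Avoids TP3 H v) (hdeg : Fintype.card V - 1 ≤ H.degree {v})
include h hdeg

theorem card_nbr_eq_two_of_avoids_TP3 {x : V} (hx : x ≠ v) : #(H.nbr v x) = 2 := by
  have hle : ∀ y ∈ univ.erase v, #(H.nbr v y) ≤ 2 := fun y hy =>
    card_nbr_le_two_of_avoids_TP3 h hdeg (Finset.ne_of_mem_erase hy)
  refine (Finset.sum_eq_sum_iff_of_le hle).1 ((Finset.sum_le_sum hle).antisymm ?_) x (by simp [hx])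
  rw [sum_erase_card_nbr, Finset.sum_const, Finset.card_erase_of_mem (Finset.mem_univ v),
    Finset.card_univ, smul_eq_mul]
  lia

theorem isEdge_trans_of_avoids_TP3 {x y z : V} (hxy : H.IsEdge v x y) (hyz : H.IsEdge v y z)
    (hxz : x ≠ z) : H.IsEdge v x z := by
  obtain ⟨w, hw, hxw⟩ := exists_isEdge_notMem (H := H) (S := {y}) (a := v) (b := x)
    (by simp [card_nbr_eq_two_of_avoids_TP3 h hdeg hxy.ne.1.symm])
  by_cases hwz : w = z
  · rwa [← hwz]
  · exact (h.no_path_TP3 hxw.swap_right hxy hyz (by simpa using hw) hwz hxz).elim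

theorem insert_nbr_eq_of_mem {x y : V} (hxy : y ∈ insert x (H.nbr v x)) :
    insert y (H.nbr v y) = insert x (H.nbr v x) := by
  ext z
  simp only [Finset.mem_insert, mem_nbr] at hxy ⊢
  grind [isEdge_trans_of_avoids_TP3 h hdeg, IsEdge.swap_right]

theorem card_insert_nbr {x : V} (hx : x ≠ v) : #(insert x (H.nbr v x)) = 3 := by
  rw [Finset.card_insert_of_notMem fun hx => (mem_nbr.1 hx).ne.2.2 rfl,
    card_nbr_eq_two_of_avoids_TP3 h hdeg hx]

theorem three_dvd_of_avoids_TP3 : 3 ∣ Fintype.card V - 1 := by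
  rw [← Finset.card_univ, ← Finset.card_erase_of_mem (Finset.mem_univ v),
    Finset.card_eq_sum_card_image (fun x => insert x (H.nbr v x))]
  refine Finset.dvd_sum fun T hT => ?_
  obtain ⟨x, hx, rfl⟩ := Finset.mem_image.1 hT
  have hxv := Finset.ne_of_mem_erase hx
  have hclass : {w ∈ univ.erase v | insert w (H.nbr v w) = insert x (H.nbr v x)} =
      insert x (H.nbr v x) := by
    ext w
    simp only [Finset.mem_filter, Finset.mem_erase, Finset.mem_univ, and_true]
    refine ⟨fun ⟨_, hw⟩ => hw ▸ Finset.mem_insert_self _ _, fun hw => ?_⟩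
    have hne : w ≠ v := by
      rcases Finset.mem_insert.1 hw with rfl | hw
      exacts [hxv, (mem_nbr.1 hw).ne.2.1.symm]
    exact ⟨hne, insert_nbr_eq_of_mem h hdeg hw⟩
  rw [hclass, card_insert_nbr h hdeg hxv]

theorem isEdge_of_isEdge_of_avoids_TP3 {x y z : V} (hxy : H.IsEdge v x y) (hxyz : H.IsEdge x y z)
    (hz : z ≠ v) : H.IsEdge v x z := by
  obtain ⟨w, hw, hxw⟩ := exists_isEdge_notMem (H := H) (S := {y}) (a := v) (b := x)
    (by simp [card_nbr_eq_two_of_avoids_TP3 h hdeg hxy.ne.1.symm])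
  by_cases hwz : w = z
  · rwa [← hwz]
  · exact (h.no_TP3 hxw.rotate.rotate hxy hxyz).elim

theorem three_mul_card_lt_of_avoids_TP3 {S : Finset V} (hv : v ∉ S)
    (hS : ∀ x ∈ S, ∀ y ∈ S, ¬ H.IsEdge v x y) : 3 * #S < Fintype.card V := by
  have hdisj : (S : Set V).PairwiseDisjoint fun x => insert x (H.nbr v x) := by
    intro x hx y hy hxy
    rw [Function.onFun, Finset.disjoint_left]
    intro z hzx hzy
    have hmem : y ∈ insert x (H.nbr v x) := by
      rw [← insert_nbr_eq_of_mem h hdeg hzx, insert_nbr_eq_of_mem h hdeg hzy]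
      exact Finset.mem_insert_self ..
    exact hS x hx y hy (by simpa [hxy.symm] using hmem)
  calc 3 * #S = #(S.biUnion fun x => insert x (H.nbr v x)) := by
        rw [Finset.card_biUnion hdisj, Finset.sum_congr rfl fun x hx =>
          card_insert_nbr h hdeg (ne_of_mem_of_not_mem hx hv), Finset.sum_const, smul_eq_mul,
          mul_comm]
    _ < Fintype.card V := Finset.card_lt_univ_of_notMem (x := v) <| by
        simp only [Finset.mem_biUnion, Finset.mem_insert, mem_nbr, not_exists]
        grind

theorem exists_degree_le_three_of_avoids_TP3 (hV : 2 ≤ Fintype.card V) (hV' : Fintype.card V ≤ 9) :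
    ∃ t, H.degree {t} ≤ 3 := by
  obtain ⟨t, ht⟩ := Fintype.exists_ne_of_one_lt_card hV v
  have hoff : #(H.linkOff t {v}) ≤ (#(H.nbr v t)).choose 2 := by
    refine card_linkOff_le_choose_two fun p q hpq hp hq => ?_
    rw [Finset.mem_singleton] at hp hq
    rw [mem_nbr]
    by_contra hne
    have hne' : ¬ H.IsEdge v t q := fun hq' =>
      hne (isEdge_of_isEdge_of_avoids_TP3 h hdeg hq' hpq.swap_right hp)
    have hpq' : ¬ H.IsEdge v p q := fun hpq' =>
      hne (isEdge_of_isEdge_of_avoids_TP3 h hdeg hpq' hpq.rotate ht).swap_right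
    have hlt := three_mul_card_lt_of_avoids_TP3 h hdeg (S := {t, p, q}) (by grind)
      (by grind [IsEdge.swap_right])
    rw [Finset.card_eq_three.2 ⟨t, p, q, hpq.ne.1, hpq.ne.2.1, hpq.ne.2.2, rfl⟩] at hlt
    lia
  refine ⟨t, (degree_le_card_nbr_add H t v).trans ?_⟩
  rw [card_nbr_eq_two_of_avoids_TP3 h hdeg ht, Nat.choose_self] at hoff
  rw [nbr_comm, card_nbr_eq_two_of_avoids_TP3 h hdeg ht]
  lia

omit h hdeg in
theorem isCoveringThreshold_TP3 {n : ℕ} (hn : 6 ≤ n) :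
    TP3.IsCoveringThreshold 1 n (if n % 3 = 1 ∧ n ≠ 7 then n - 1 else n - 2) := by
  refine isCoveringThreshold_one (by lia) ?_ fun H v hdeg h => ?_
  · split_ifs with hmod
    · convert hasUncovered_TP3_of_modEq_one (k := n / 3) (by lia) using 1 <;> lia
    · exact hasUncovered_TP3 hn
  · have hlt := degree_lt_card_of_avoids_TP3 h
    have hdegv := hdeg v
    rw [Fintype.card_fin] at hlt
    split_ifs at hdeg hdegv with hmod
    · lia
    have hdeg' : Fintype.card (Fin n) - 1 ≤ H.degree {v} := by rw [Fintype.card_fin]; lia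
    have hdvd := three_dvd_of_avoids_TP3 h hdeg'
    rw [Fintype.card_fin] at hdvd
    obtain rfl : n = 7 := by lia
    obtain ⟨t, ht⟩ := exists_degree_le_three_of_avoids_TP3 h hdeg' (by simp) (by simp)
    have := hdeg t
    lia

end TP3

section GP3

variable {V : Type*} [DecidableEq V] {H : UniformHypergraph V 3} {v a b c p q s w x y z : V}

theorem isEdge_meets_of_avoids_GP3 (h : Avoids GP3 H v) (hya : H.IsEdge v y a)
    (haw : H.IsEdge v a w) (hyw : y ≠ w) (hpq : H.IsEdge y p q) (hp : p ≠ v) (hq : q ≠ v) :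
    p = a ∨ q = a ∨ p = w ∨ q = w := by
  by_contra! hne
  exact h.no_GP3 haw.rotate.rotate hya.swap_right hpq.swap.swap

theorem eq_or_eq_of_avoids_GP3 (h : Avoids GP3 H v) (hya : H.IsEdge v y a)
    (hpq : H.IsEdge v p q) (hdisj : [y, a, p, q].Nodup) (hyaz : H.IsEdge y a z) (hz : z ≠ v) :
    z = p ∨ z = q := by
  by_contra! hne
  exact h.no_GP3 hyaz.rotate.rotate hya.rotate hpq

variable [Fintype V]

theorem eq_or_eq_of_four_le_of_avoids_GP3 (h : Avoids GP3 H v) (hya : H.IsEdge v y a)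
    (ha : 4 ≤ #(H.nbr v a)) (hpq : H.IsEdge y p q) (hp : p ≠ v) (hq : q ≠ v) : p = a ∨ q = a := by
  obtain ⟨w, hw, haw⟩ := exists_isEdge_notMem (S := {y, p, q}) (Finset.card_le_three.trans_lt ha)
  have := isEdge_meets_of_avoids_GP3 h hya haw (by grind) hpq hp hq
  grind

section Cherry

variable (h : Avoids GP3 H v) (hab : H.IsEdge v a b) (hac : H.IsEdge v a c)
include h hab hac

theorem le_card_nbr_of_cherry_of_avoids_GP3 (ha : 3 ≤ #(H.nbr v a)) (hpq : H.IsEdge v p q)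
    (hdisj : [a, b, c, p, q].Nodup) : H.degree {b} ≤ #(H.nbr v b) + 3 := by
  obtain ⟨w, hw, haw⟩ := exists_isEdge_notMem (S := {b, c}) (Finset.card_le_two.trans_lt ha)
  have hoff : #(H.linkOff b {v}) ≤ #{s(a, p), s(a, q), s(c, w)} := by
    refine card_linkOff_le fun r s hrs hr hs => ?_
    simp only [Finset.mem_singleton, Finset.mem_insert] at hr hs hw ⊢
    have hmeetc := isEdge_meets_of_avoids_GP3 h hab.swap_right hac (by grind) hrs hr hs
    have hmeetw := isEdge_meets_of_avoids_GP3 h hab.swap_right haw (by grind) hrs hr hs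
    have hba : ∀ z, H.IsEdge b a z → z ≠ v → z = p ∨ z = q := fun z =>
      eq_or_eq_of_avoids_GP3 h hab.swap_right hpq (by grind)
    by_cases hra : r = a
    · have := hba s (hra ▸ hrs) hs
      grind
    by_cases hsa : s = a
    · have := hba r (hsa ▸ hrs.swap_right) hr
      grind
    grind
  rw [nbr_comm H v b]
  exact (degree_le_card_nbr_add H b v).trans
    (Nat.add_le_add_left (hoff.trans Finset.card_le_three) _)

theorem degree_le_card_nbr_add_two_of_avoids_GP3 (hb : 4 ≤ #(H.nbr v b)) (hbs : H.IsEdge v b s)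
    (hdisj : [a, b, c, s].Nodup) : H.degree {s} ≤ #(H.nbr v s) + 2 := by
  have hoff : #(H.linkOff s {v}) ≤ #{s(b, a), s(b, c)} := by
    refine card_linkOff_le fun r t hrt hr ht => ?_
    simp only [Finset.mem_singleton, Finset.mem_insert] at hr ht ⊢
    have hsb : ∀ z, H.IsEdge s b z → z ≠ v → z = a ∨ z = c := fun z =>
      eq_or_eq_of_avoids_GP3 h hbs.swap_right hac (by grind)
    rcases eq_or_eq_of_four_le_of_avoids_GP3 h hbs.swap_right hb hrt hr ht with rfl | rfl
    · have := hsb t hrt ht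
      grind
    · have := hsb r hrt.swap_right hr
      grind
  rw [nbr_comm H v s]
  exact (degree_le_card_nbr_add H s v).trans
    (Nat.add_le_add_left (hoff.trans Finset.card_le_two) _)

theorem false_of_cherry_of_avoids_GP3 (hn : 14 ≤ Fintype.card V)
    (hdeg : ∀ x, Fintype.card V - 1 ≤ H.degree {x}) (ha : 3 ≤ #(H.nbr v a)) (hpq : H.IsEdge v p q)
    (hdisj : [a, b, c, p, q].Nodup) : False := by
  have hb := (hdeg b).trans (le_card_nbr_of_cherry_of_avoids_GP3 h hab hac ha hpq hdisj)
  have hnbr : ∀ s, H.IsEdge v b s → s ≠ a → s ≠ c → Fintype.card V - 1 ≤ #(H.nbr v s) + 2 := by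
    intro s hbs hsa hsc
    have hs : [a, b, c, s].Nodup := by clear hdeg; grind
    exact (hdeg s).trans (degree_le_card_nbr_add_two_of_avoids_GP3 h hab hac (by lia) hbs hs)
  obtain ⟨s, hsac, hbs⟩ := exists_isEdge_notMem (H := H) (S := {a, c}) (a := v) (b := b)
    (Finset.card_le_two.trans_lt (by lia))
  simp only [Finset.mem_insert, Finset.mem_singleton, not_or] at hsac
  have hs := hnbr s hbs hsac.1 hsac.2
  have hcommon : 1 < #((H.nbr v b ∩ H.nbr v s) \ {a, c}) := by
    have := Finset.card_union_add_card_inter (H.nbr v b) (H.nbr v s)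
    have := Finset.card_le_univ (H.nbr v b ∪ H.nbr v s)
    have := Finset.le_card_sdiff {a, c} (H.nbr v b ∩ H.nbr v s)
    have := Finset.card_le_two (a := a) (b := c)
    lia
  obtain ⟨t, ht, u, hu, htu⟩ := Finset.one_lt_card.1 hcommon
  simp only [Finset.mem_sdiff, Finset.mem_inter, mem_nbr, Finset.mem_insert, Finset.mem_singleton,
    not_or] at ht hu
  have hthrough : ∀ x y, H.IsEdge s x y → x = v ∨ y = v := by
    intro x y hxy
    by_contra! hne
    have hb' := eq_or_eq_of_four_le_of_avoids_GP3 h hbs.swap_right (by lia) hxy hne.1 hne.2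
    have ht' := eq_or_eq_of_four_le_of_avoids_GP3 h ht.1.2
      (by have := hnbr t ht.1.1 ht.2.1 ht.2.2; lia) hxy hne.1 hne.2
    have hu' := eq_or_eq_of_four_le_of_avoids_GP3 h hu.1.2
      (by have := hnbr u hu.1.1 hu.2.1 hu.2.2; lia) hxy hne.1 hne.2
    have := ht.1.1.ne
    have := hu.1.1.ne
    clear hdeg hnbr
    grind
  have := degree_add_two_le hbs.ne.2.1.symm hthrough
  have := hdeg s
  lia

end Cherry

section

variable (h : Avoids GP3 H v) (hn : 14 ≤ Fintype.card V)
  (hdeg : ∀ x, Fintype.card V - 1 ≤ H.degree {x})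
include h hn hdeg

theorem card_nbr_le_three_of_avoids_GP3 : #(H.nbr v a) ≤ 3 := by
  by_contra! ha
  have hav : v ≠ a := by
    rintro rfl
    simp at ha
  have hdegv := (hdeg v).trans (degree_le_card_nbr_add H v a)
  have := card_nbr_add_two_le H hav
  obtain ⟨p, q, hpq, hp, hq⟩ := exists_isEdge_of_linkOff_pos (H := H) (v := v) (X := {a}) (by lia)
  obtain ⟨b, c, hbc, hb, hc, hab, hac⟩ := exists_two_isEdge_notMem (H := H) (S := {p, q}) (a := v)
    (b := a) ((Nat.succ_le_succ Finset.card_le_two).trans_lt ha)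
  have hdisj : [a, b, c, p, q].Nodup := by clear hdeg; grind
  exact false_of_cherry_of_avoids_GP3 h hab hac hn hdeg ha.le hpq hdisj

theorem exists_isEdge_notMem_of_avoids_GP3 {S : Finset V} (hS : #S ≤ 3) :
    ∃ p q, H.IsEdge v p q ∧ p ∉ S ∧ q ∉ S := by
  have hsum := Finset.sum_le_card_nsmul S (fun a => #(H.nbr v a)) 3 fun a _ =>
    card_nbr_le_three_of_avoids_GP3 h hn hdeg
  have hdegv := (hdeg v).trans (degree_le_sum_card_nbr_add H v S)
  rw [smul_eq_mul] at hsum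
  exact exists_isEdge_of_linkOff_pos (by lia)

theorem card_nbr_le_two_of_avoids_GP3 : #(H.nbr v a) ≤ 2 := by
  by_contra! ha
  obtain ⟨b, c, hbc, -, -, hab, hac⟩ := exists_two_isEdge_notMem (H := H) (S := ∅) (a := v)
    (b := a) (by simpa using Nat.lt_of_succ_lt ha)
  obtain ⟨p, q, hpq, hp, hq⟩ := exists_isEdge_notMem_of_avoids_GP3 h hn hdeg (S := {a, b, c})
    Finset.card_le_three
  have hdisj : [a, b, c, p, q].Nodup := by clear hdeg; grind
  exact false_of_cherry_of_avoids_GP3 h hab hac hn hdeg ha hpq hdisj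

theorem card_nbr_le_one_of_avoids_GP3 : #(H.nbr v a) ≤ 1 := by
  by_contra! ha
  obtain ⟨y, w, hyw, -, -, hay, haw⟩ := exists_two_isEdge_notMem (H := H) (S := ∅) (a := v)
    (b := a) (by simpa using ha)
  have hya : ∀ z, H.IsEdge y a z → z = v := by
    intro z hz
    by_contra hzv
    obtain ⟨p, q, hpq, hp, hq⟩ := exists_isEdge_notMem_of_avoids_GP3 h hn hdeg (S := {y, a, z})
      Finset.card_le_three
    have hdisj : [y, a, p, q].Nodup := by clear hdeg; grind
    have := eq_or_eq_of_avoids_GP3 h hay.swap_right hpq hdisj hz hzv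
    clear hdeg
    grind
  have hoff : #(H.linkOff y {w, v}) = 0 := by
    refine card_linkOff_eq_zero fun p q hpq hp => ?_
    by_contra hq
    simp only [Finset.mem_insert, Finset.mem_singleton, not_or] at hp hq
    have hpa := hya p
    have hqa := hya q
    have := isEdge_meets_of_avoids_GP3 h hay.swap_right haw hyw hpq hp.2 hq.2
    clear hdeg hya
    grind [IsEdge.swap_right]
  have hnbr : #(H.nbr y w \ {v}) + 4 ≤ Fintype.card V := by
    have hcard : #{v, y, w, a} = 4 := by
      clear hdeg hya
      exact Finset.card_eq_four.2 ⟨v, y, w, a, by grind⟩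
    rw [← hcard, ← Finset.card_union_of_disjoint]
    · exact Finset.card_le_univ _
    · rw [Finset.disjoint_left]
      intro c hc
      have := hya w
      clear hdeg
      grind [mem_nbr, IsEdge.swap_right]
  have := (hdeg y).trans (degree_le_card_nbr_add_card_sdiff_add H y v w)
  have := card_nbr_le_two_of_avoids_GP3 h hn hdeg (a := y)
  rw [nbr_comm] at this
  lia

end

theorem isCoveringThreshold_GP3 {n : ℕ} (hn : 14 ≤ n) : GP3.IsCoveringThreshold 1 n (n - 2) := by
  refine isCoveringThreshold_one (by lia) (hasUncovered_GP3 (by lia)) fun H v hdeg h => ?_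
  have hdeg' : ∀ x, Fintype.card (Fin n) - 1 ≤ H.degree {x} := by
    simpa [show n - 2 + 1 = n - 1 by lia] using hdeg
  have hle := two_mul_degree_le fun x _ =>
    card_nbr_le_one_of_avoids_GP3 h (by simpa using hn) hdeg' (a := x)
  have := hdeg v
  rw [Fintype.card_fin] at hle
  lia

end GP3

section Intersecting

theorem star_or_triangle {V : Type*} {G : SimpleGraph V}
    (h : ∀ p q r s, G.Adj p q → G.Adj r s → ¬ [p, q, r, s].Nodup) :
    (∃ c, ∀ p q, G.Adj p q → p = c ∨ q = c) ∨
      ∃ T : Finset V, #T ≤ 3 ∧ ∀ p q, G.Adj p q → p ∈ T := by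
  classical
  by_contra! ⟨hstar, htri⟩
  obtain ⟨a, b, hab, -⟩ := htri ∅ (by simp)
  obtain ⟨p, q, hpq, hpa, hqa⟩ := hstar a
  obtain ⟨r, s, hrs, hrb, hsb⟩ := hstar b
  obtain ⟨c, hbc, hca⟩ : ∃ c, G.Adj b c ∧ c ≠ a := by
    have := h _ _ _ _ hab hpq
    have := hab.ne
    have := hpq.ne
    have : p = b ∨ q = b := by clear h hstar htri; grind
    rcases this with rfl | rfl
    exacts [⟨q, hpq, hqa⟩, ⟨p, hpq.symm, hpa⟩]
  have hac : G.Adj a c := by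
    have := h _ _ _ _ hab hrs
    have := h _ _ _ _ hbc hrs
    have := hrs.symm
    have := hab.ne
    have := hbc.ne
    have := hrs.ne
    clear h hstar htri
    grind
  obtain ⟨x, y, hxy, hx⟩ := htri {a, b, c} Finset.card_le_three
  have := h _ _ _ _ hab hxy
  have := h _ _ _ _ hbc hxy
  have := h _ _ _ _ hac hxy
  have := hab.ne
  have := hbc.ne
  have := hac.ne
  have := hxy.ne
  clear h hstar htri
  grind

variable {V : Type*} [DecidableEq V] [Fintype V] {H : UniformHypergraph V 3} {v : V}
  {X : Finset V}

/-- Any two edges of the link of `v` that avoid `X` share a vertex. -/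
def LinkIntersecting (H : UniformHypergraph V 3) (v : V) (X : Finset V) : Prop :=
  ∀ p q r s, s(p, q) ∈ H.linkOff v X → s(r, s) ∈ H.linkOff v X → ¬ [p, q, r, s].Nodup

theorem LinkIntersecting.star_or_triangle (h : H.LinkIntersecting v X) :
    (∃ c, ∀ p q, s(p, q) ∈ H.linkOff v X → p = c ∨ q = c) ∨
      ∃ T : Finset V, #T ≤ 3 ∧ ∀ p q, s(p, q) ∈ H.linkOff v X → p ∈ T := by
  have hadj : ∀ p q, (SimpleGraph.fromEdgeSet (H.linkOff v X : Set (Sym2 V))).Adj p q ↔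
      s(p, q) ∈ H.linkOff v X := fun p q => by
    rw [SimpleGraph.fromEdgeSet_adj, Finset.mem_coe, and_iff_left_iff_imp]
    exact fun hpq => (mk_mem_linkOff.1 hpq).1.ne.2.2
  simpa only [hadj] using UniformHypergraph.star_or_triangle
    (G := SimpleGraph.fromEdgeSet (H.linkOff v X : Set (Sym2 V)))
    (by simpa only [hadj] using fun p q r s => h p q r s)

theorem LinkIntersecting.card_linkOff_le (h : H.LinkIntersecting v X) :
    #(H.linkOff v X) ≤ 3 ∨ ∃ c ∉ insert v X, #(H.linkOff v X) ≤ #(H.nbr v c \ X) := by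
  rcases h.star_or_triangle with ⟨c, hc⟩ | ⟨T, hT, hmem⟩
  · refine or_iff_not_imp_left.2 fun hlt => ⟨c, fun hcX => ?_, ?_⟩
    · obtain ⟨p, q, hpq, hp, hq⟩ := exists_isEdge_of_linkOff_pos (H := H) (v := v) (X := X) (by lia)
      rcases hc p q (mk_mem_linkOff.2 ⟨hpq, hp, hq⟩) with rfl | rfl <;> grind
    · have hoff : #(H.linkOff v (insert c X)) = 0 := card_linkOff_eq_zero fun p q hpq hp => by
        have := @hc p q
        grind [mk_mem_linkOff]
      simpa [hoff] using card_linkOff_le_add H v X c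
  · refine .inl ((card_linkOff_le_choose_two fun p q hpq hp hq =>
      hmem p q (mk_mem_linkOff.2 ⟨hpq, hp, hq⟩)).trans ?_)
    simpa using Nat.choose_le_choose 2 hT

theorem LinkIntersecting.card_linkOff_le_max (h : H.LinkIntersecting v X) (hv : v ∉ X) :
    #(H.linkOff v X) ≤ max 3 (Fintype.card V - (#X + 2)) := by
  rcases h.card_linkOff_le with hle | ⟨c, hc, hle⟩
  · exact hle.trans (le_max_left ..)
  · have hsub : H.nbr v c \ X ⊆ (insert c (insert v X))ᶜ := by
      intro z hz
      rw [Finset.mem_sdiff, mem_nbr] at hz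
      rw [Finset.mem_compl]
      grind
    have := Finset.card_le_card hsub
    rw [Finset.card_compl, Finset.card_insert_of_notMem hc, Finset.card_insert_of_notMem hv] at this
    lia

end Intersecting

section S3

variable {V : Type*} [DecidableEq V] [Fintype V] {H : UniformHypergraph V 3}
  {v a b c d x y : V}

theorem nbr_subset_of_avoids_S3 (h : Avoids S3 H v) (hab : H.IsEdge v a b) (hcd : H.IsEdge v c d)
    (hdisj : [x, a, b, c, d].Nodup) : H.nbr v x ⊆ {a, b, c, d} := by
  intro z hz
  rw [mem_nbr] at hz
  by_contra hmem
  exact h.no_S3 hab hcd hz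

theorem linkIntersecting_of_isEdge_of_avoids_S3 (h : Avoids S3 H v) (hca : H.IsEdge v c a) :
    H.LinkIntersecting c {a, v} := by
  intro p q r s hpq hrs hdisj
  rw [mk_mem_linkOff] at hpq hrs
  exact h.no_S3 hca.swap hpq.1 hrs.1

theorem linkIntersecting_singleton_of_five_le (h : Avoids S3 H v) (hx : 5 ≤ #(H.nbr v x)) :
    H.LinkIntersecting x {v} := by
  intro p q r s hpq hrs hdisj
  obtain ⟨a, ha, hxa⟩ := exists_isEdge_notMem (S := {p, q, r, s}) (Finset.card_le_four.trans_lt hx)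
  rw [mk_mem_linkOff] at hpq hrs
  exact h.no_S3 hxa.swap hpq.1 hrs.1

theorem linkIntersecting_of_five_le (h : Avoids S3 H v) (hx : 5 ≤ #(H.nbr v x)) :
    H.LinkIntersecting v {x} := by
  intro p q r s hpq hrs hdisj
  rw [mk_mem_linkOff] at hpq hrs
  have := Finset.card_le_card (nbr_subset_of_avoids_S3 h (x := x) hpq.1 hrs.1 (by grind))
  have := this.trans Finset.card_le_four
  lia

section

variable (h : Avoids S3 H v) (hdeg : ∀ x, Fintype.card V ≤ H.degree {x})
include h hdeg

theorem two_le_card_nbr_sdiff_of_avoids_S3 (hn : 7 ≤ Fintype.card V) (hxy : H.IsEdge v x y)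
    (hy : #(H.nbr v y) ≤ 2) : 2 ≤ #(H.nbr y x \ {v}) := by
  have hoff := (linkIntersecting_of_isEdge_of_avoids_S3 h hxy.swap_right).card_linkOff_le_max
    (by clear hdeg; grind)
  rw [Finset.card_pair hxy.ne.1.symm] at hoff
  have := (hdeg y).trans (degree_le_card_nbr_add_card_sdiff_add H y v x)
  rw [nbr_comm] at hy
  lia

theorem card_light_nbr_le_three_of_avoids_S3 (hn : 7 ≤ Fintype.card V) (hx : 5 ≤ #(H.nbr v x)) :
    #{y ∈ H.nbr v x | #(H.nbr v y) ≤ 2} ≤ 3 := by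
  have hlight : ∀ y, H.IsEdge v x y → #(H.nbr v y) ≤ 2 →
      ∃ p q, p ≠ q ∧ s(y, p) ∈ H.linkOff x {v} ∧ s(y, q) ∈ H.linkOff x {v} := by
    intro y hxy hy
    obtain ⟨p, hp, q, hq, hpq⟩ := Finset.one_lt_card.1
      (two_le_card_nbr_sdiff_of_avoids_S3 h hdeg hn hxy hy)
    refine ⟨p, q, hpq, ?_, ?_⟩ <;> clear hdeg <;> grind [mem_nbr, mk_mem_linkOff, IsEdge.swap]
  rcases (linkIntersecting_singleton_of_five_le h hx).star_or_triangle with ⟨c, hc⟩ | ⟨T, hT, hmem⟩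
  · have hsub : {y ∈ H.nbr v x | #(H.nbr v y) ≤ 2} ⊆ {c} := by
      intro y hy
      rw [Finset.mem_filter, mem_nbr] at hy
      obtain ⟨p, q, hpq, hp, hq⟩ := hlight y hy.1 hy.2
      have := hc y p hp
      have := hc y q hq
      grind
    exact (Finset.card_le_card hsub).trans (by simp)
  · refine (Finset.card_le_card fun y hy => ?_).trans hT
    rw [Finset.mem_filter, mem_nbr] at hy
    obtain ⟨p, -, -, hp, -⟩ := hlight y hy.1 hy.2
    exact hmem y p hp

theorem card_nbr_le_four_of_avoids_S3 (hn : 11 ≤ Fintype.card V) : #(H.nbr v x) ≤ 4 := by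
  by_contra! hx
  have hlight := card_light_nbr_le_three_of_avoids_S3 h hdeg (by lia) hx
  have hdegv := (hdeg v).trans (degree_le_card_nbr_add H v x)
  have hnbr : ∀ y z, y ∈ H.nbr v x → z ∈ H.nbr v y → z ≠ x → s(y, z) ∈ H.linkOff v {x} := by
    clear hdeg
    grind [mem_nbr, mk_mem_linkOff]
  rcases (linkIntersecting_of_five_le h hx).star_or_triangle with ⟨c, hc⟩ | ⟨T, hT, hmem⟩
  · have hsub : (H.nbr v x).erase c ⊆ {y ∈ H.nbr v x | #(H.nbr v y) ≤ 2} := by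
      intro y hy
      rw [Finset.mem_erase] at hy
      refine Finset.mem_filter.2 ⟨hy.2, (Finset.card_le_card fun z hz => ?_).trans
        (Finset.card_le_two (a := x) (b := c))⟩
      have := hnbr y z hy.2 hz
      have := hc y z
      grind
    have := Finset.card_le_card hsub
    have := Finset.pred_card_le_card_erase (s := H.nbr v x) (a := c)
    lia
  · have hoff : #(H.linkOff v {x}) ≤ 3 := (card_linkOff_le_choose_two fun p q hpq hp hq =>
      hmem p q (mk_mem_linkOff.2 ⟨hpq, hp, hq⟩)).trans (Nat.choose_le_choose 2 hT)
    have hsub : H.nbr v x \ T ⊆ {y ∈ H.nbr v x | #(H.nbr v y) ≤ 2} := by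
      intro y hy
      rw [Finset.mem_sdiff] at hy
      refine Finset.mem_filter.2 ⟨hy.1, (Finset.card_le_card (t := {x}) fun z hz => ?_).trans
        (by simp)⟩
      have := hnbr y z hy.1 hz
      have := hmem y z
      grind
    have := Finset.card_le_card hsub
    have := Finset.le_card_sdiff T (H.nbr v x)
    lia

end

theorem mem_nbr_of_four_le_of_avoids_S3 (h : Avoids S3 H v) (hx : 4 ≤ #(H.nbr v x))
    (hab : H.IsEdge v a b) (hcd : H.IsEdge v c d) (hdisj : [x, a, b, c, d].Nodup) {p q : V}
    (hpq : H.IsEdge v p q) (hp : p ≠ x) (hq : q ≠ x) : p ∈ H.nbr v x := by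
  have hnbr : H.nbr v x = {a, b, c, d} := Finset.eq_of_subset_of_card_le
    (nbr_subset_of_avoids_S3 h hab hcd hdisj) (Finset.card_le_four.trans hx)
  by_contra hpx
  rw [hnbr] at hpx
  by_cases hqab : q = a ∨ q = b
  · have := nbr_subset_of_avoids_S3 h (x := x) hcd hpq (by grind)
    simp only [hnbr, Finset.insert_subset_iff] at this
    grind
  · have := nbr_subset_of_avoids_S3 h (x := x) hab hpq (by grind)
    simp only [hnbr, Finset.insert_subset_iff] at this
    grind

theorem card_nbr_le_three_of_avoids_S3 (h : Avoids S3 H v) (hdeg : 11 ≤ H.degree {v})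
    (h4 : ∀ x, #(H.nbr v x) ≤ 4) : #(H.nbr v x) ≤ 3 := by
  by_contra! hx
  suffices hoff : #(H.linkOff v {x}) ≤ 6 by
    have := degree_le_card_nbr_add H v x
    have := h4 x
    lia
  by_cases hint : H.LinkIntersecting v {x}
  · rcases hint.card_linkOff_le with hle | ⟨c, -, hle⟩
    · lia
    · have := (hle.trans (Finset.card_le_card Finset.sdiff_subset)).trans (h4 c)
      lia
  · simp only [LinkIntersecting, not_forall, not_not, mk_mem_linkOff] at hint
    obtain ⟨a, b, c, d, hab, hcd, hdisj⟩ := hint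
    have hmem := card_linkOff_le_choose_two (H := H) (v := v) (X := {x}) (T := H.nbr v x)
      fun p q hpq hp hq => mem_nbr_of_four_le_of_avoids_S3 h hx hab.1 hcd.1 (by grind) hpq
        (by simpa using hp) (by simpa using hq)
    exact hmem.trans (Nat.choose_le_choose 2 (h4 x))

theorem card_linkOff_lt_add (hab : H.IsEdge v a b) (X : Finset V) :
    #(H.linkOff v X) < #(H.nbr v a) + #(H.nbr v b) + #(H.linkOff v (insert b (insert a X))) := by
  have hlt : #(H.nbr v b \ insert a X) < #(H.nbr v b) :=
    Finset.card_lt_card <| Finset.ssubset_iff_subset_ne.2 ⟨Finset.sdiff_subset, fun heq => by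
      have := heq.ge (mem_nbr.2 hab.swap_right)
      simp at this⟩
  have hle := Finset.card_le_card (Finset.sdiff_subset (s := H.nbr v a) (t := X))
  have := card_linkOff_le_add H v X a
  have := card_linkOff_le_add H v (insert a X) b
  lia

theorem degree_lt_eleven_of_avoids_S3 (h : Avoids S3 H v) (h3 : ∀ x, #(H.nbr v x) ≤ 3) :
    H.degree {v} < 11 := by
  by_contra! hdeg
  have hstep : ∀ X a b, H.IsEdge v a b →
      #(H.linkOff v X) ≤ 5 + #(H.linkOff v (insert b (insert a X))) := by
    intro X a b hab
    have := card_linkOff_lt_add hab X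
    have := h3 a
    have := h3 b
    lia
  have hdegv := degree_le_sum_card_nbr_add H v ∅
  rw [Finset.sum_empty] at hdegv
  obtain ⟨a, b, hab, -, -⟩ := exists_isEdge_of_linkOff_pos (H := H) (v := v) (X := ∅) (by lia)
  have hab5 := hstep ∅ a b hab
  obtain ⟨c, d, hcd, hc, hd⟩ := exists_isEdge_of_linkOff_pos (H := H) (v := v) (X := {b, a}) (by
    rw [insert_empty_eq] at hab5; lia)
  have hcd5 := hstep {b, a} c d hcd
  obtain ⟨e, f, hef, he, hf⟩ := exists_isEdge_of_linkOff_pos (H := H) (v := v) (X := {d, c, b, a})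
    (by rw [insert_empty_eq] at hab5; lia)
  clear hstep h3
  exact h.no_S3 hab hcd hef

theorem isCoveringThreshold_S3 {n : ℕ} (hn : 11 ≤ n) : S3.IsCoveringThreshold 1 n (n - 1) := by
  refine isCoveringThreshold_one (by lia) (hasUncovered_S3 (by lia)) fun H v hdeg h => ?_
  rw [Nat.sub_add_cancel (by lia)] at hdeg
  have h4 : ∀ x, #(H.nbr v x) ≤ 4 := fun x =>
    card_nbr_le_four_of_avoids_S3 h (by simpa using hdeg) (by simpa using hn)
  have := degree_lt_eleven_of_avoids_S3 h fun x =>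
    card_nbr_le_three_of_avoids_S3 h (hn.trans (hdeg v)) h4
  have := hdeg v
  lia

end S3

section LP3

variable {V : Type*} [DecidableEq V] {H : UniformHypergraph V 3}
  {v a b c d e f p q s w x y z : V}

theorem isEdge_meets_of_avoids_LP3 (h : Avoids LP3 H v) (hya : H.IsEdge v y a)
    (hcd : H.IsEdge v c d) (hdisj : [y, a, c, d].Nodup) (hpq : H.IsEdge y p q) (hp : p ≠ v)
    (hq : q ≠ v) : p ∈ ({a, c, d} : Finset V) ∨ q ∈ ({a, c, d} : Finset V) := by
  by_contra! hne
  exact h.no_LP3 hcd.rotate hya.swap_right hpq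

variable [Fintype V]

theorem eq_or_eq_of_five_le_of_avoids_LP3 (h : Avoids LP3 H v) (hxy : x ≠ y)
    (hx : 5 ≤ #(H.nbr v x)) (hy : 5 ≤ #(H.nbr v y)) (hpq : H.IsEdge x p q) (hp : p ≠ v)
    (hq : q ≠ v) : p = y ∨ q = y := by
  by_contra! hne
  obtain ⟨t, ht, hyt⟩ := exists_isEdge_notMem (S := {p, q, x})
    (Finset.card_le_three.trans_lt (Nat.lt_of_succ_lt hy))
  obtain ⟨s, hs, hxs⟩ := exists_isEdge_notMem (S := {p, q, y, t}) (Finset.card_le_four.trans_lt hx)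
  have := isEdge_meets_of_avoids_LP3 h hxs hyt (by grind) hpq hp hq
  grind

theorem degree_add_two_le_of_five_le_of_avoids_LP3 (h : Avoids LP3 H v) (hxv : x ≠ v)
    (hdisj : [x, a, b, c].Nodup) (hbig : ∀ y ∈ [x, a, b, c], 5 ≤ #(H.nbr v y)) :
    H.degree {x} + 2 ≤ Fintype.card V := by
  have hmem : ∀ y ∈ [a, b, c], ∀ p q, H.IsEdge x p q → p ≠ v → q ≠ v → p = y ∨ q = y :=
    fun y hy p q => eq_or_eq_of_five_le_of_avoids_LP3 h (by grind) (hbig x (by simp))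
      (hbig y (List.mem_cons_of_mem _ hy))
  refine degree_add_two_le hxv fun p q hpq => ?_
  by_contra! hne
  have ha := hmem a (by simp) p q hpq hne.1 hne.2
  have hb := hmem b (by simp) p q hpq hne.1 hne.2
  have hc := hmem c (by simp) p q hpq hne.1 hne.2
  clear hmem hbig
  grind

theorem degree_le_card_nbr_add_seven_of_avoids_LP3 (h : Avoids LP3 H v) (hya : H.IsEdge v y a)
    (hbc : H.IsEdge v b c) (hde : H.IsEdge v d e) (hdisj : [y, a, b, c, d, e].Nodup)
    (hsmall : #(H.nbr y a \ {v}) ≤ 3) : H.degree {y} ≤ #(H.nbr v y) + 7 := by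
  have hoff : #(H.linkOff y {a, v}) ≤ #{s(b, d), s(b, e), s(c, d), s(c, e)} := by
    refine card_linkOff_le fun p q hpq hp hq => ?_
    simp only [Finset.mem_insert, Finset.mem_singleton, not_or] at hp hq
    have hmeetbc := isEdge_meets_of_avoids_LP3 h hya hbc (by grind) hpq hp.2 hq.2
    have hmeetde := isEdge_meets_of_avoids_LP3 h hya hde (by grind) hpq hp.2 hq.2
    simp only [Finset.mem_insert, Finset.mem_singleton, Sym2.eq_iff] at hmeetbc hmeetde ⊢
    grind
  have := hoff.trans Finset.card_le_four
  have := degree_le_card_nbr_add_card_sdiff_add H y v a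
  rw [nbr_comm H v y]
  lia

section

variable (h : Avoids LP3 H v) (hya : H.IsEdge v y a) (hcd : H.IsEdge v c d)
  (hdisj : [y, a, c, d].Nodup)
include h hya hcd hdisj

theorem nbr_subset_of_four_le_of_avoids_LP3 (hlarge : 4 ≤ #(H.nbr y a \ {v})) :
    H.nbr v y ⊆ {a, c, d} := by
  intro s hs
  rw [mem_nbr] at hs
  by_contra hmem
  obtain ⟨q, hq, hqs⟩ := Finset.exists_mem_notMem_of_card_lt_card
    ((Finset.card_le_three (a := s) (b := c) (c := d)).trans_lt hlarge)
  simp only [Finset.mem_sdiff, mem_nbr, Finset.mem_singleton] at hq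
  have := isEdge_meets_of_avoids_LP3 h hs hcd (by grind) hq.1 hya.ne.2.1.symm hq.2
  grind

theorem eq_or_eq_of_four_le_of_avoids_LP3 (hlarge : 4 ≤ #(H.nbr y a \ {v}))
    (hcz : H.IsEdge c y z) (hz : z ≠ v) : z = a ∨ z = d := by
  by_contra! hne
  obtain ⟨q, hq, hqS⟩ := Finset.exists_mem_notMem_of_card_lt_card
    ((Finset.card_le_three (a := c) (b := d) (c := z)).trans_lt hlarge)
  rw [Finset.mem_sdiff, mem_nbr] at hq
  exact h.no_LP3 hcd.swap_right hcz.swap_right hq.1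

variable (hlarge : 4 ≤ #(H.nbr y a \ {v}))
include hlarge

theorem isEdge_meets_of_four_le_of_avoids_LP3 (hpq : H.IsEdge c p q) (hp : p ≠ v) (hq : q ≠ v) :
    p = d ∨ q = d ∨ s(p, q) = s(y, a) := by
  have hmeet := isEdge_meets_of_avoids_LP3 h hcd hya (by grind) hpq hp hq
  have hy : ∀ z, H.IsEdge c y z → z ≠ v → z = a ∨ z = d := fun z =>
    eq_or_eq_of_four_le_of_avoids_LP3 h hya hcd hdisj hlarge
  have ha : ∀ z, H.IsEdge c a z → z ≠ v → z = y ∨ z = d := fun z =>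
    eq_or_eq_of_four_le_of_avoids_LP3 h hya.swap_right hcd (by grind) (by rwa [nbr_comm])
  have := hy p
  have := hy q
  have := ha p
  have := ha q
  clear hy ha
  grind [IsEdge.swap_right]

theorem degree_le_card_nbr_add_four_of_avoids_LP3 (hsmall : #(H.nbr c d \ {v}) ≤ 3) :
    H.degree {c} ≤ #(H.nbr v c) + 4 := by
  have hoff : #(H.linkOff c {d, v}) ≤ #{s(y, a)} := by
    refine card_linkOff_le fun p q hpq hp hq => ?_
    have := isEdge_meets_of_four_le_of_avoids_LP3 h hya hcd hdisj hlarge hpq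
    grind
  rw [Finset.card_singleton] at hoff
  have := degree_le_card_nbr_add_card_sdiff_add H c v d
  rw [nbr_comm H v c]
  lia

theorem mem_of_five_le_of_avoids_LP3 (hc : 5 ≤ #(H.nbr v c)) (hpq : H.IsEdge c p q) (hp : p ≠ v)
    (hq : q ≠ v) : p ∈ ({y, a, d} : Finset V) := by
  by_contra hmem
  have hqd := isEdge_meets_of_four_le_of_avoids_LP3 h hya hcd hdisj hlarge hpq hp hq
  obtain ⟨t, ht, hct⟩ := exists_isEdge_notMem (S := {p, y, a, d}) (Finset.card_le_four.trans_lt hc)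
  have := isEdge_meets_of_avoids_LP3 h hct hya (by grind) hpq hp hq
  grind

theorem degree_add_two_le_of_four_le_of_avoids_LP3 (hc : 5 ≤ #(H.nbr v c))
    (hd : 5 ≤ #(H.nbr v d)) (hcs : H.IsEdge v c s) (hds : H.IsEdge v d s) (hsy : s ≠ y)
    (hsa : s ≠ a) : H.degree {s} + 2 ≤ Fintype.card V := by
  have hsc : ∀ z, H.IsEdge c s z → z = v := fun z hz => by
    by_contra hzv
    have := mem_of_five_le_of_avoids_LP3 h hya hcd hdisj hlarge hc hz hcs.ne.2.1.symm hzv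
    grind
  have hsd : ∀ z, H.IsEdge d s z → z = v := fun z hz => by
    by_contra hzv
    have := mem_of_five_le_of_avoids_LP3 h hya hcd.swap_right (by grind) hlarge hd hz
      hcs.ne.2.1.symm hzv
    grind
  refine degree_add_two_le hcs.ne.2.1.symm fun p q hpq => ?_
  by_contra! hne
  have hmem : p ∉ ({c, d} : Finset V) ∧ q ∉ ({c, d} : Finset V) := by
    simp only [Finset.mem_insert, Finset.mem_singleton]
    refine ⟨?_, ?_⟩ <;> rintro (rfl | rfl)
    exacts [hne.2 (hsc _ hpq.swap), hne.2 (hsd _ hpq.swap), hne.1 (hsc _ hpq.rotate.rotate),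
      hne.1 (hsd _ hpq.rotate.rotate)]
  clear hsc hsd
  obtain ⟨t, ht, hdt⟩ := exists_isEdge_notMem (S := {s, c, p, q}) (Finset.card_le_four.trans_lt hd)
  have := isEdge_meets_of_avoids_LP3 h hcs.swap_right hdt (by grind) hpq hne.1 hne.2
  grind

end

theorem exists_isEdge_notMem_of_avoids_LP3 (h : Avoids LP3 H v) (hdeg : 7 ≤ H.degree {v})
    (hya : H.IsEdge v y a) (hcd : H.IsEdge v c d) (hdisj : [y, a, c, d].Nodup)
    (hlarge : 4 ≤ #(H.nbr y a \ {v})) (hlarge' : 4 ≤ #(H.nbr c d \ {v})) :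
    ∃ e f, H.IsEdge v e f ∧ e ∉ ({y, a, c, d} : Finset V) ∧ f ∉ ({y, a, c, d} : Finset V) := by
  have hy := nbr_subset_of_four_le_of_avoids_LP3 h hya hcd hdisj hlarge
  have ha := nbr_subset_of_four_le_of_avoids_LP3 h hya.swap_right hcd (by grind)
    (by rwa [nbr_comm])
  have hc := nbr_subset_of_four_le_of_avoids_LP3 h hcd hya (by grind) hlarge'
  have hd := nbr_subset_of_four_le_of_avoids_LP3 h hcd.swap_right hya (by grind)
    (by rwa [nbr_comm])
  have hclosed : ∀ p q, H.IsEdge v p q → p ∈ ({y, a, c, d} : Finset V) →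
      q ∈ ({y, a, c, d} : Finset V) := by
    intro p q hpq hp
    have := mem_nbr.2 hpq
    grind
  by_contra! hne
  have hoff : #(H.linkOff v ∅) ≤ 6 :=
    (card_linkOff_le_choose_two fun p q hpq _ _ => by_contra fun hp =>
      hp (hclosed q p hpq.swap_right (hne p q hpq hp))).trans
      (Nat.choose_le_choose 2 Finset.card_le_four)
  have hall := degree_le_sum_card_nbr_add H v ∅
  rw [Finset.sum_empty] at hall
  lia

theorem eq_of_four_le_of_avoids_LP3 (h : Avoids LP3 H v) (hya : H.IsEdge v y a)
    (hcd : H.IsEdge v c d) (hef : H.IsEdge v e f) (hdisj : [y, a, c, d, e, f].Nodup)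
    (hlarge : 4 ≤ #(H.nbr y a \ {v})) (hs : H.IsEdge v y s) : s = a := by
  have hcd' := nbr_subset_of_four_le_of_avoids_LP3 h hya hcd (by grind) hlarge (mem_nbr.2 hs)
  have hef' := nbr_subset_of_four_le_of_avoids_LP3 h hya hef (by grind) hlarge (mem_nbr.2 hs)
  grind

section

variable (h : Avoids LP3 H v) (hn : 13 ≤ Fintype.card V)
  (hdeg : ∀ x, Fintype.card V - 1 ≤ H.degree {x})
include h hn hdeg

theorem four_le_of_four_le_of_avoids_LP3 (hya : H.IsEdge v y a) (hcd : H.IsEdge v c d)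
    (hdisj : [y, a, c, d].Nodup) (hlarge : 4 ≤ #(H.nbr y a \ {v})) :
    4 ≤ #(H.nbr c d \ {v}) := by
  by_contra! hsmall
  have hdisj' : [y, a, d, c].Nodup := by clear hdeg; grind
  have hc := (hdeg c).trans
    (degree_le_card_nbr_add_four_of_avoids_LP3 h hya hcd hdisj hlarge (by lia))
  have hd := (hdeg d).trans (degree_le_card_nbr_add_four_of_avoids_LP3 h hya hcd.swap_right hdisj'
    hlarge (by rw [nbr_comm]; lia))
  have hcommon : #{y, a} < #(H.nbr v c ∩ H.nbr v d) := by
    have := Finset.card_union_add_card_inter (H.nbr v c) (H.nbr v d)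
    have := Finset.card_le_univ (H.nbr v c ∪ H.nbr v d)
    have := Finset.card_le_two (a := y) (b := a)
    lia
  obtain ⟨s, hs, hsya⟩ := Finset.exists_mem_notMem_of_card_lt_card hcommon
  simp only [Finset.mem_inter, mem_nbr, Finset.mem_insert, Finset.mem_singleton, not_or] at hs hsya
  have := degree_add_two_le_of_four_le_of_avoids_LP3 h hya hcd hdisj hlarge (by lia) (by lia)
    hs.1 hs.2 hsya.1 hsya.2
  have := hdeg s
  lia

theorem card_nbr_le_one_of_four_le_of_avoids_LP3 (hya : H.IsEdge v y a) (hcd : H.IsEdge v c d)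
    (hdisj : [y, a, c, d].Nodup) (hlarge : 4 ≤ #(H.nbr y a \ {v})) (x : V) :
    #(H.nbr v x) ≤ 1 := by
  have hlarge' : ∀ p q, H.IsEdge v p q → [y, a, p, q].Nodup → 4 ≤ #(H.nbr p q \ {v}) :=
    fun p q hpq hpq' => four_le_of_four_le_of_avoids_LP3 h hn hdeg hya hpq hpq' hlarge
  obtain ⟨e, f, hef, he, hf⟩ := exists_isEdge_notMem_of_avoids_LP3 h
    ((by lia : 7 ≤ Fintype.card V - 1).trans (hdeg v)) hya hcd hdisj hlarge
    (hlarge' c d hcd hdisj)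
  clear hdeg
  have hy : ∀ s, H.IsEdge v y s → s = a := fun s =>
    eq_of_four_le_of_avoids_LP3 h hya hcd hef (by clear hlarge'; grind) hlarge
  have ha : ∀ s, H.IsEdge v a s → s = y := fun s =>
    eq_of_four_le_of_avoids_LP3 h hya.swap_right hcd hef (by clear hlarge' hy; grind)
      (by rwa [nbr_comm])
  refine Finset.card_le_one.2 fun p hp q hq => ?_
  rw [mem_nbr] at hp hq
  by_cases hxy : x = y
  · rw [hy p (hxy ▸ hp), hy q (hxy ▸ hq)]
  by_cases hxa : x = a
  · rw [ha p (hxa ▸ hp), ha q (hxa ▸ hq)]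
  have hnot : ∀ r, H.IsEdge v x r → r ≠ y ∧ r ≠ a := fun r hr =>
    ⟨fun hry => hxa (hy x (hry ▸ hr.swap_right)), fun hra => hxy (ha x (hra ▸ hr.swap_right))⟩
  have hp' := hnot p hp
  have hq' := hnot q hq
  have hxp := hlarge' x p hp
  clear hlarge' hy ha hnot
  have := nbr_subset_of_four_le_of_avoids_LP3 h hp hya (by grind) (hxp (by grind)) (mem_nbr.2 hq)
  grind

theorem card_nbr_sdiff_le_three_of_avoids_LP3 (hya : H.IsEdge v y a) (hcd : H.IsEdge v c d)
    (hdisj : [y, a, c, d].Nodup) : #(H.nbr y a \ {v}) ≤ 3 := by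
  by_contra! hlarge
  have := two_mul_degree_le fun x _ =>
    card_nbr_le_one_of_four_le_of_avoids_LP3 h hn hdeg hya hcd hdisj hlarge x
  have := hdeg v
  lia

theorem five_le_card_nbr_of_avoids_LP3 (hya : H.IsEdge v y a) (hbc : H.IsEdge v b c)
    (hde : H.IsEdge v d e) (hdisj : [y, a, b, c, d, e].Nodup) : 5 ≤ #(H.nbr v y) := by
  have hsmall := card_nbr_sdiff_le_three_of_avoids_LP3 h hn hdeg hya hbc
    (by clear hdeg; grind)
  have := degree_le_card_nbr_add_seven_of_avoids_LP3 h hya hbc hde hdisj hsmall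
  have := hdeg y
  lia

end

theorem degree_le_card_nbr_add_six_of_avoids_LP3 (h : Avoids LP3 H v) (hab : H.IsEdge v a b)
    (haw : H.IsEdge v a w) (hcd : H.IsEdge v c d) (hdisj : [a, b, w, c, d].Nodup)
    (hsmall : #(H.nbr b a \ {v}) ≤ 3) : H.degree {b} ≤ #(H.nbr v b) + 6 := by
  have hoff : #(H.linkOff b {a, v}) ≤ #{s(c, d), s(c, w), s(d, w)} := by
    refine card_linkOff_le fun p q hpq hp hq => ?_
    simp only [Finset.mem_insert, Finset.mem_singleton, not_or] at hp hq ⊢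
    have hmeet := isEdge_meets_of_avoids_LP3 h hab.swap_right hcd (by grind) hpq hp.2 hq.2
    have hcw : ∀ z, H.IsEdge b c z → z ≠ v → z ≠ a → z = d ∨ z = w := fun z hz hzv hza => by
      have := isEdge_meets_of_avoids_LP3 h hcd haw (by grind) hz.swap hab.ne.2.1.symm hzv
      grind
    have hdw : ∀ z, H.IsEdge b d z → z ≠ v → z ≠ a → z = c ∨ z = w := fun z hz hzv hza => by
      have := isEdge_meets_of_avoids_LP3 h hcd.swap_right haw (by grind) hz.swap hab.ne.2.1.symm hzv
      grind
    have := hcw p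
    have := hcw q
    have := hdw p
    have := hdw q
    clear hcw hdw
    grind [IsEdge.swap_right]
  have := hoff.trans Finset.card_le_three
  have := degree_le_card_nbr_add_card_sdiff_add H b v a
  rw [nbr_comm H v b]
  lia

theorem false_of_cherry_of_avoids_LP3 (h : Avoids LP3 H v) (hn : 13 ≤ Fintype.card V)
    (hdeg : ∀ x, Fintype.card V - 1 ≤ H.degree {x}) (hab : H.IsEdge v a b)
    (haw : H.IsEdge v a w) (hcd : H.IsEdge v c d) (hdisj : [a, b, w, c, d].Nodup) : False := by
  have hdisj' : [b, a, c, d].Nodup := by clear hdeg; grind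
  have hb := (hdeg b).trans (degree_le_card_nbr_add_six_of_avoids_LP3 h hab haw hcd hdisj
    (card_nbr_sdiff_le_three_of_avoids_LP3 h hn hdeg hab.swap_right hcd hdisj'))
  obtain ⟨s, hs, hbs⟩ := exists_isEdge_notMem (H := H) (S := {a, c, d, w}) (a := v) (b := b)
    (Finset.card_le_four.trans_lt (by lia))
  have hmatch : [c, d, b, s, a, w].Nodup := by clear hdeg; grind
  have hmatch' : [d, c, b, s, a, w].Nodup := by clear hdeg; grind
  have hmatch'' : [a, w, c, d, b, s].Nodup := by clear hdeg; grind
  have hc := five_le_card_nbr_of_avoids_LP3 h hn hdeg hcd hbs haw hmatch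
  have hd := five_le_card_nbr_of_avoids_LP3 h hn hdeg hcd.swap_right hbs haw hmatch'
  have ha := five_le_card_nbr_of_avoids_LP3 h hn hdeg haw hcd hbs hmatch''
  have hdisj'' : [b, c, d, a].Nodup := by clear hdeg; grind
  have := degree_add_two_le_of_five_le_of_avoids_LP3 h hab.ne.2.1.symm hdisj'' (by
    simpa using ⟨by lia, hc, hd, ha⟩)
  have := hdeg b
  lia

theorem isCoveringThreshold_LP3 {n : ℕ} (hn : 13 ≤ n) : LP3.IsCoveringThreshold 1 n (n - 2) := by
  refine isCoveringThreshold_one (by lia) (hasUncovered_LP3 (by lia)) fun H v hdeg h => ?_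
  have hn' : 13 ≤ Fintype.card (Fin n) := by simpa using hn
  have hdeg' : ∀ x, Fintype.card (Fin n) - 1 ≤ H.degree {x} := by
    simpa [show n - 2 + 1 = n - 1 by lia] using hdeg
  have hv := hdeg' v
  rcases link_star_or_matching (H := H) (v := v) (by lia) fun a x y p q hax hay hpq hdisj =>
    false_of_cherry_of_avoids_LP3 h hn' hdeg' hax hay hpq hdisj with ⟨x, hx⟩ | hmatch
  · have hvx : v ≠ x := by
      rintro rfl
      have := degree_le_card_nbr hx
      simp at this
      lia
    have := degree_add_two_le hvx hx
    lia
  · have := two_mul_degree_le fun x _ => hmatch x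
    lia

end LP3

end UniformHypergraph

theorem theorem3 :
    (∀ n : ℕ, 13 ≤ n → LP3.IsCoveringThreshold 1 n (n - 2)) ∧
    (∀ n : ℕ, 6 ≤ n →
      TP3.IsCoveringThreshold 1 n (if n % 3 = 1 ∧ n ≠ 7 then n - 1 else n - 2)) ∧
    (∀ n : ℕ, 14 ≤ n → GP3.IsCoveringThreshold 1 n (n - 2)) ∧
    (∀ n : ℕ, 9 ≤ n → K113.IsCoveringThreshold 1 n (n - 1)) ∧
    (∀ n : ℕ, 11 ≤ n → S3.IsCoveringThreshold 1 n (n - 1)) ∧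
    (∀ n : ℕ, 13 ≤ n → GS3.IsCoveringThreshold 1 n ((n - 1) / 2)) :=
  ⟨fun _ hn => UniformHypergraph.isCoveringThreshold_LP3 hn,
    fun _ hn => UniformHypergraph.isCoveringThreshold_TP3 hn,
    fun _ hn => UniformHypergraph.isCoveringThreshold_GP3 hn,
    fun _ hn => UniformHypergraph.isCoveringThreshold_K113 hn,
    fun _ hn => UniformHypergraph.isCoveringThreshold_S3 hn,
    fun _ hn => UniformHypergraph.isCoveringThreshold_GS3 hn⟩
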